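/- A bamboo garden consists of $n\ge 1$ bamboos with growth rates $h_1,\dots,h_n>0$, $\sum_i h_i=1$ (given in any order). Days are numbered $0,1,2,\dots$; all heights are initially $0$, bamboo $i$ grows by $h_i$ during each day, and at the end of each day the gardener may reset the height of at most one bamboo to $0$. For a threshold $x>0$, the strategy Reduce-Fastest$(x)$ trims, at the end of each day, the bamboo of largest growth rate among those of height at least $x$ (the one of smallest index in case of ties), and trims nothing if there is no such bamboo. A trimming oracle is a pair of programs (Build, Query) for a unit-cost random access machine with constantly many registers and an addressable memory, whose operations are $+,-,\cdot$, the rounded quotients $\lfloor a/b\rfloor,\lceil a/b\rceil$, comparisons, and indirect loads and stores. Build is run once on the input $(n,x,h_1,\dots,h_n)$; thereafter Query is run at the end of each day on the state left by the preceding run and reports the bamboo to trim on that day, or that none is to be trimmed. **Theorem.** There are a trimming oracle and an absolute constant $C$ such that, for all $n\ge 1$, all gardens $h_1,\dots,h_n$ and all $x>0$, the oracle reports, on every day, exactly the bamboo trimmed by Reduce-Fastest$(x)$ (or that none is trimmed), and - Build takes at most $C\,n\,(\lfloor\log_2 n\rfloor+1)$ steps; - every single Query takes at most $C\,(\lfloor\log_2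 n\rfloor+1)$ steps (worst case); - over the whole infinite run only memory cells with addresses less than $C\,n$ are accessed; - every value ever written is one of the input numbers $x,h_1,\dots,h_n$ or an integer of absolute value at most $C\,(n+x/\min_i h_i)$. In particular, if the input numbers and $x/\min_i h_i$ fit into a constant number of memory words, so does every stored value. That is: there is a trimming oracle implementing Reduce-Fastest$(x)$ that uses $O(n)$ space, can be built in $O(n\log n)$ time, and reports the next bamboo to trim in $O(\log n)$ worst-case time. -/

import Mathlib

/-! Bamboo gardens, the strategy Reduce-Fastest(x), and a unit-cost random access machine. -/

namespace BGT

/-! ### Gardens and schedules -/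

/-- A bamboo garden: `n` bamboos with positive daily growth rates that sum up to `1`.
The rates are not assumed to be given in sorted order. -/
structure Garden (n : ℕ) where
  rate : Fin n → ℝ
  rate_pos : ∀ i, 0 < rate i
  sum_rate : ∑ i, rate i = 1

/-- A perpetual schedule: the bamboo trimmed at the end of each day `0, 1, 2, …`, if any. -/
abbrev Schedule (n : ℕ) := ℕ → Option (Fin n)

/-- Height of a bamboo at the end of day `d` (days start from `0`), before the gardener trims:
every bamboo has height `0` at the beginning, grows by its rate on every day, and is reset to
height `0` when it is trimmed. -/
noncomputable def Garden.height {n : ℕ} (G : Garden n) (s : Schedule n) : ℕ → Fin n → ℝ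
  | 0, i => G.rate i
  | d + 1, i => (if s d = some i then 0 else G.height s d i) + G.rate i

/-- `s` is the schedule of Reduce-Fastest(x): at the end of every day, among the bamboos of height
at least `x`, the one of fastest growth rate is trimmed (ties are broken in favour of the smallest
index), and nothing is trimmed if no bamboo has height at least `x`. -/
def Garden.IsReduceFastest {n : ℕ} (G : Garden n) (x : ℝ) (s : Schedule n) : Prop :=
  ∀ d : ℕ,
    (s d = none → ∀ i, G.height s d i < x) ∧
    (∀ i, s d = some i →
      x ≤ G.height s d i ∧
      ∀ j, x ≤ G.height s d j → G.rate j < G.rate i ∨ (G.rate j = G.rate i ∧ i ≤ j))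

/-! ### The machine

A state consists of registers, which are named explicitly by a program (so a program uses only
constantly many of them), and of an addressable memory.  Cells hold numbers.  Every arithmetic
operation, memory access and comparison takes one step. -/

structure State where
  reg : ℕ → ℝ
  mem : ℕ → ℝ

inductive Operand where
  | const (k : ℕ)
  | reg (r : ℕ)

def Operand.val (s : State) : Operand → ℝ
  | .const k => k
  | .reg r => s.reg r

inductive ArithOp where
  | add
  | sub
  | mul
  | floorDiv
  | ceilDiv

noncomputable def ArithOp.eval : ArithOp → ℝ → ℝ → ℝ
  | .add, a, b => a + b
  | .sub, a, b => a - b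
  | .mul, a, b => a * b
  | .floorDiv, a, b => (⌊a / b⌋ : ℤ)
  | .ceilDiv, a, b => (⌈a / b⌉ : ℤ)

/-- Divisions are defined only if the divisor is not zero. -/
def ArithOp.Defined : ArithOp → ℝ → Prop
  | .floorDiv, b => b ≠ 0
  | .ceilDiv, b => b ≠ 0
  | _, _ => True

inductive Test where
  | eq (a b : Operand)
  | lt (a b : Operand)
  | le (a b : Operand)

def Test.Holds (s : State) : Test → Prop
  | .eq a b => a.val s = b.val s
  | .lt a b => a.val s < b.val s
  | .le a b => a.val s ≤ b.val s

/-- Programs. -/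
inductive Prog where
  | skip
  /-- `R[dst] := a ∘ b` -/
  | arith (dst : ℕ) (op : ArithOp) (a b : Operand)
  /-- `R[dst] := M[addr]` -/
  | load (dst : ℕ) (addr : Operand)
  /-- `M[addr] := src` -/
  | store (addr src : Operand)
  | seq (p q : Prog)
  | branch (t : Test) (p q : Prog)
  | loop (t : Test) (p : Prog)

def State.setReg (s : State) (r : ℕ) (v : ℝ) : State :=
  { s with reg := Function.update s.reg r v }

def State.setMem (s : State) (k : ℕ) (v : ℝ) : State :=
  { s with mem := Function.update s.mem k v }

/-- `Exec S V p s t s'`: the program `p`, started in state `s`, halts after exactly `t` steps in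
state `s'`; on the way it accesses only memory cells with address less than `S`, and every value
that it writes into a register or a memory cell belongs to `V`. A division by zero, or an
address that is not a natural number less than `S`, has no execution. -/
inductive Exec (S : ℕ) (V : Set ℝ) : Prog → State → ℕ → State → Prop where
  | skip (s : State) : Exec S V .skip s 1 s
  | arith (s : State) (dst : ℕ) (op : ArithOp) (a b : Operand)
      (hdef : op.Defined (b.val s)) (hV : op.eval (a.val s) (b.val s) ∈ V) :
      Exec S V (.arith dst op a b) s 1 (s.setReg dst (op.eval (a.val s) (b.val s)))
  | load (s : State) (dst : ℕ) (addr : Operand) (k : ℕ)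
      (haddr : addr.val s = k) (hS : k < S) (hV : s.mem k ∈ V) :
      Exec S V (.load dst addr) s 1 (s.setReg dst (s.mem k))
  | store (s : State) (addr src : Operand) (k : ℕ)
      (haddr : addr.val s = k) (hS : k < S) (hV : src.val s ∈ V) :
      Exec S V (.store addr src) s 1 (s.setMem k (src.val s))
  | seq (p q : Prog) (s s' s'' : State) (t t' : ℕ)
      (hp : Exec S V p s t s') (hq : Exec S V q s' t' s'') :
      Exec S V (.seq p q) s (t + t') s''
  | branch_true (c : Test) (p q : Prog) (s s' : State) (t : ℕ)
      (hc : c.Holds s) (hp : Exec S V p s t s') :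
      Exec S V (.branch c p q) s (t + 1) s'
  | branch_false (c : Test) (p q : Prog) (s s' : State) (t : ℕ)
      (hc : ¬ c.Holds s) (hq : Exec S V q s t s') :
      Exec S V (.branch c p q) s (t + 1) s'
  | loop_stop (c : Test) (p : Prog) (s : State) (hc : ¬ c.Holds s) :
      Exec S V (.loop c p) s 1 s
  | loop_step (c : Test) (p : Prog) (s s' s'' : State) (t t' : ℕ)
      (hc : c.Holds s) (hp : Exec S V p s t s') (hl : Exec S V (.loop c p) s' t' s'') :
      Exec S V (.loop c p) s (t + t' + 1) s''

/-! ### Trimming oracles -/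

/-- A trimming oracle is given by two programs: one that builds the data structure, and one that is
run at the end of every day and works on the state left by the previous run. -/
structure TrimmingOracle where
  build : Prog
  query : Prog

/-- The initial state: register `0` holds `n`, register `1` holds `x`, memory cell `i` holds the
growth rate of bamboo `i` for `i < n`, and everything else is `0`. -/
noncomputable def inputState {n : ℕ} (G : Garden n) (x : ℝ) : State where
  reg := fun r => if r = 0 then (n : ℝ) else if r = 1 then x else 0
  mem := fun k => if hk : k < n then G.rate ⟨k, hk⟩ else 0

/-- Answers are encoded as numbers: `0` is "do nothing", `i + 1` is "trim bamboo `i`". -/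
def encodeAnswer {n : ℕ} : Option (Fin n) → ℝ
  | none => 0
  | some i => ((i : ℕ) : ℝ) + 1

/-- The values that a cell may hold: one of the input numbers, or an integer of absolute value
at most `C * (n + x / h)`, where `h` is the smallest growth rate. -/
def allowedValues {n : ℕ} (G : Garden n) (x : ℝ) (C : ℕ) : Set ℝ :=
  {v | v = x ∨ (∃ i, v = G.rate i) ∨
    ∃ z : ℤ, v = z ∧ ∃ i, |(z : ℝ)| ≤ (C : ℝ) * ((n : ℝ) + x / G.rate i)}

/-- On garden `G` and threshold `x`, the oracle answers according to the schedule `s` forever (the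
answer for day `d` is found in register `0` after the query of day `d`).  Building takes at most `B`
steps, each single query takes at most `Q` steps, the memory cells used over the whole infinite run
have addresses less than `S`, and all values written belong to `V`. -/
def TrimmingOracle.Follows (O : TrimmingOracle) {n : ℕ} (G : Garden n) (x : ℝ) (s : Schedule n)
    (S : ℕ) (V : Set ℝ) (B Q : ℕ) : Prop :=
  ∃ σ : ℕ → State,
    (∃ t ≤ B, Exec S V O.build (inputState G x) t (σ 0)) ∧
    ∀ d : ℕ, (∃ t ≤ Q, Exec S V O.query (σ d) t (σ (d + 1))) ∧
      (σ (d + 1)).reg 0 = encodeAnswer (s d)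

end BGT

/-! A bamboo of rate `h` that has grown for `e` days has height `e * h`, so it reaches `x` exactly
when `e ≥ ⌈x / h⌉`. Heights can therefore be replaced by integer waiting times. Give each bamboo a
position in the order of increasing rates (among equal rates the larger index first) and a key: the
time at which it becomes ready. Reduce-Fastest then trims the last position whose key is at most the
current time. A tournament tree of minima over the positions finds that position by one descent and
changes a key by one ascent, both in logarithmic time.

Absolute times would grow without bound. The clock therefore runs only from `1` to `n` and restarts,
and at each restart all keys must drop by `n`. Doing this at once would cost linear time in a single
query, so a second tree is prepared in the background: each day of the epoch copies one position
into it, reduced by `n` and cut off at `0`, and each trim is entered in both trees. After `n` days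
the second tree is complete and the two trees exchange roles. The cut-off is harmless: key `0` lies
below every clock value, so an overdue bamboo stays ready. The invariant `Ready` says that the
remaining wait read off the key, `κ j - τ`, equals the true one, `p j - e j`, both in truncated
subtraction.

The positions are computed by a selection sort that uses the second tree as a priority queue. The
lemmas that carry the argument are `wp_update` and `wp_find` for the trees, `wp_query` for one day,
`wp_build` for the construction, and `isReduceFastest_of_isChoice` for the passage from waiting
times back to heights. -/

namespace BGT

/-! ### A calculus of programs -/

/-- The program `p`, started in `s`, halts after some number `t` of steps in some state `s'`
with `Q t s'`. -/
def wp (S : ℕ) (V : Set ℝ) (p : Prog) (s : State) (Q : ℕ → State → Prop) : Prop :=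
  ∃ t s', Exec S V p s t s' ∧ Q t s'

section calculus

variable {S : ℕ} {V : Set ℝ} {s : State} {Q : ℕ → State → Prop}

@[simp] lemma setReg_reg (s : State) (r r' : ℕ) (v : ℝ) :
    (s.setReg r v).reg r' = if r' = r then v else s.reg r' := by
  simp [State.setReg, Function.update_apply]

@[simp] lemma setReg_mem (s : State) (r : ℕ) (v : ℝ) : (s.setReg r v).mem = s.mem := rfl

@[simp] lemma setMem_reg (s : State) (k : ℕ) (v : ℝ) : (s.setMem k v).reg = s.reg := rfl

@[simp] lemma setMem_mem (s : State) (k k' : ℕ) (v : ℝ) :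
    (s.setMem k v).mem k' = if k' = k then v else s.mem k' := by
  simp [State.setMem, Function.update_apply]

@[simp] lemma val_const (s : State) (k : ℕ) : (Operand.const k).val s = k := rfl

@[simp] lemma val_reg (s : State) (r : ℕ) : (Operand.reg r).val s = s.reg r := rfl

@[simp] lemma holds_lt (s : State) (a b : Operand) :
    (Test.lt a b).Holds s ↔ a.val s < b.val s := Iff.rfl

@[simp] lemma holds_le (s : State) (a b : Operand) :
    (Test.le a b).Holds s ↔ a.val s ≤ b.val s := Iff.rfl

@[simp] lemma eval_add (a b : ℝ) : ArithOp.add.eval a b = a + b := rfl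

@[simp] lemma eval_sub (a b : ℝ) : ArithOp.sub.eval a b = a - b := rfl

lemma wp_skip (h : Q 1 s) : wp S V .skip s Q := ⟨1, s, .skip s, h⟩

lemma wp_arith {dst : ℕ} {op : ArithOp} {a b : Operand} (v : ℝ)
    (hd : op.Defined (b.val s)) (hv : op.eval (a.val s) (b.val s) = v) (hV : v ∈ V)
    (h : Q 1 (s.setReg dst v)) : wp S V (.arith dst op a b) s Q := by
  subst hv
  exact ⟨1, _, .arith s dst op a b hd hV, h⟩

lemma wp_add {dst : ℕ} {a b : Operand} (v : ℝ) (hv : a.val s + b.val s = v) (hV : v ∈ V)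
    (h : Q 1 (s.setReg dst v)) : wp S V (.arith dst .add a b) s Q :=
  wp_arith v trivial hv hV h

lemma wp_sub {dst : ℕ} {a b : Operand} (v : ℝ) (hv : a.val s - b.val s = v) (hV : v ∈ V)
    (h : Q 1 (s.setReg dst v)) : wp S V (.arith dst .sub a b) s Q :=
  wp_arith v trivial hv hV h

lemma wp_half {dst : ℕ} {a : Operand} (k : ℕ) (hk : a.val s = k) (hV : ((k / 2 : ℕ) : ℝ) ∈ V)
    (h : Q 1 (s.setReg dst ((k / 2 : ℕ) : ℝ))) :
    wp S V (.arith dst .floorDiv a (.const 2)) s Q := by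
  refine wp_arith _ ?_ ?_ hV h
  · simp [ArithOp.Defined]
  · have : ⌊(k : ℝ) / ((2 : ℕ) : ℝ)⌋ = ((k / 2 : ℕ) : ℤ) := by
      rw [← Nat.floor_div_eq_div (K := ℝ) k 2, Int.natCast_floor_eq_floor (by positivity)]
    simp only [ArithOp.eval, val_const, hk, this, Int.cast_natCast]

lemma wp_load {dst : ℕ} {addr : Operand} (k : ℕ) (v : ℝ) (ha : addr.val s = k) (hS : k < S)
    (hv : s.mem k = v) (hV : v ∈ V) (h : Q 1 (s.setReg dst v)) :
    wp S V (.load dst addr) s Q := by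
  subst hv
  exact ⟨1, _, .load s dst addr k ha hS hV, h⟩

lemma wp_store {addr src : Operand} (k : ℕ) (v : ℝ) (ha : addr.val s = k) (hS : k < S)
    (hv : src.val s = v) (hV : v ∈ V) (h : Q 1 (s.setMem k v)) :
    wp S V (.store addr src) s Q := by
  subst hv
  exact ⟨1, _, .store s addr src k ha hS hV, h⟩

lemma wp_seq {p q : Prog} (h : wp S V p s fun t s' => wp S V q s' fun t' s'' => Q (t + t') s'') :
    wp S V (.seq p q) s Q :=
  let ⟨t, s', he, t', s'', he', hq⟩ := h
  ⟨t + t', s'', .seq p q s s' s'' t t' he he', hq⟩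

lemma wp_branch {c : Test} {p q : Prog} (hp : c.Holds s → wp S V p s fun t s' => Q (t + 1) s')
    (hq : ¬ c.Holds s → wp S V q s fun t s' => Q (t + 1) s') : wp S V (.branch c p q) s Q := by
  by_cases hc : c.Holds s
  · obtain ⟨t, s', he, h⟩ := hp hc
    exact ⟨t + 1, s', .branch_true c p q s s' t hc he, h⟩
  · obtain ⟨t, s', he, h⟩ := hq hc
    exact ⟨t + 1, s', .branch_false c p q s s' t hc he, h⟩

/-- A loop with invariant `I j`, where `j` bounds the number of remaining iterations, each of which
takes at most `T` steps. -/
lemma wp_loop {c : Test} {p : Prog} (I : ℕ → State → Prop) (T : ℕ)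
    (hstep : ∀ j s, I j s → c.Holds s →
      ∃ j', j = j' + 1 ∧ wp S V p s fun t s' => t ≤ T ∧ I j' s')
    (j : ℕ) (h0 : I j s)
    (hQ : ∀ t s' j', t ≤ j * (T + 1) + 1 → I j' s' → ¬ c.Holds s' → Q t s') :
    wp S V (.loop c p) s Q := by
  induction j generalizing s Q with
  | zero =>
    by_cases hc : c.Holds s
    · obtain ⟨j', h, -⟩ := hstep _ _ h0 hc
      omega
    · exact ⟨1, s, Exec.loop_stop c p s hc, hQ _ _ _ (by omega) h0 hc⟩
  | succ j ih =>
    by_cases hc : c.Holds s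
    · obtain ⟨j', h, t, s', he, ht, hI⟩ := hstep _ _ h0 hc
      obtain rfl : j = j' := by omega
      obtain ⟨t', s'', he', hq⟩ := ih (s := s') (Q := fun t' s'' => Q (t + t' + 1) s'') hI
        fun t' s'' j' ht' hI' hc' => hQ _ _ _ (by rw [add_mul]; omega) hI' hc'
      exact ⟨_, s'', .loop_step c p s s' s'' t t' hc he he', hq⟩
    · exact ⟨1, s, Exec.loop_stop c p s hc, hQ _ _ _ (by omega) h0 hc⟩

end calculus

/-! ### Tournament trees -/

/-- The cells `base + 1, …, base + (2 * m - 1)` hold a tournament tree whose leaves are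
`f 0, …, f (m - 1)`, and every inner node is the minimum of its two children. -/
structure IsTree (V : Set ℝ) (mem : ℕ → ℝ) (base m : ℕ) (f : ℕ → ℝ) : Prop where
  leaf : ∀ j < m, mem (base + (m + j)) = f j
  node : ∀ k, 1 ≤ k → k < m → mem (base + k) = min (mem (base + 2 * k)) (mem (base + (2 * k + 1)))
  mem_values : ∀ k, 1 ≤ k → k < 2 * m → mem (base + k) ∈ V

/-- A frame rule: it lets one tree survive writes to the other tree or to the tables. -/
lemma IsTree.congr {V : Set ℝ} {mem mem' : ℕ → ℝ} {base m : ℕ} {f f' : ℕ → ℝ}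
    (h : IsTree V mem base m f) (hmem : ∀ i, base ≤ i → i < base + 2 * m → mem' i = mem i)
    (hf : ∀ j < m, f' j = f j) : IsTree V mem' base m f' where
  leaf j hj := by rw [hmem _ (by omega) (by omega), h.leaf j hj, hf j hj]
  node k h1 h2 := by
    rw [hmem _ (by omega) (by omega), hmem _ (by omega) (by omega), hmem _ (by omega) (by omega),
      h.node k h1 h2]
  mem_values k h1 h2 := by
    rw [hmem _ (by omega) (by omega)]
    exact h.mem_values k h1 h2

/-- In heap numbering the descendants of `k` that lie `i` levels below it form the block from `k * 2
^ i` up to, but excluding, `(k + 1) * 2 ^ i`; the induction passes to the child whose half of the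
block contains `l`. -/
lemma IsTree.le_descendant {V : Set ℝ} {mem : ℕ → ℝ} {base m : ℕ} {f : ℕ → ℝ}
    (h : IsTree V mem base m f) (i k l : ℕ) (hk : 1 ≤ k) (h1 : k * 2 ^ i ≤ l)
    (h2 : l < (k + 1) * 2 ^ i) (hl : l < 2 * m) : mem (base + k) ≤ mem (base + l) := by
  induction i generalizing k with
  | zero =>
    obtain rfl : k = l := by omega
    exact le_rfl
  | succ i ih =>
    have hpos : 0 < 2 ^ i := by positivity
    have hkm : k < m := by
      rw [pow_succ] at h1
      nlinarith
    rw [h.node k hk hkm]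
    rw [pow_succ] at h1 h2
    rcases lt_or_ge l ((2 * k + 1) * 2 ^ i) with hlt | hge
    · exact (min_le_left _ _).trans
        (ih (2 * k) (by omega) (by linarith) (by linarith))
    · exact (min_le_right _ _).trans
        (ih (2 * k + 1) (by omega) hge (by linarith))

lemma IsTree.root_le {V : Set ℝ} {mem : ℕ → ℝ} {base L : ℕ} {f : ℕ → ℝ}
    (h : IsTree V mem base (2 ^ L) f) {j : ℕ} (hj : j < 2 ^ L) : mem (base + 1) ≤ f j := by
  rw [← h.leaf j hj]
  exact h.le_descendant L 1 _ le_rfl (by omega) (by omega) (by omega)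

/-- Set leaf `R[9]` of the tree at `R[8]` to `R[10]`; `R[3]` is the number of leaves. -/
def update : Prog :=
  .seq (.arith 11 .add (.reg 3) (.reg 9)) <|
  .seq (.arith 12 .add (.reg 8) (.reg 11)) <|
  .seq (.store (.reg 12) (.reg 10)) <|
  .loop (.lt (.const 1) (.reg 11)) <|
    .seq (.arith 11 .floorDiv (.reg 11) (.const 2)) <|
    .seq (.arith 12 .add (.reg 11) (.reg 11)) <|
    .seq (.arith 12 .add (.reg 8) (.reg 12)) <|
    .seq (.load 13 (.reg 12)) <|
    .seq (.arith 12 .add (.reg 12) (.const 1)) <|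
    .seq (.load 14 (.reg 12)) <|
    .seq (.arith 12 .add (.reg 8) (.reg 11)) <|
    .branch (.le (.reg 13) (.reg 14)) (.store (.reg 12) (.reg 13)) (.store (.reg 12) (.reg 14))

/-- Report in `R[9]` the last leaf of the tree at `R[8]` whose key is at most `R[10]`;
`R[3]` is the number of leaves. -/
def find : Prog :=
  .seq (.arith 11 .add (.const 1) (.const 0)) <|
  .seq (.loop (.lt (.reg 11) (.reg 3)) <|
    .seq (.arith 11 .add (.reg 11) (.reg 11)) <|
    .seq (.arith 11 .add (.reg 11) (.const 1)) <|
    .seq (.arith 12 .add (.reg 8) (.reg 11)) <|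
    .seq (.load 13 (.reg 12)) <|
    .branch (.le (.reg 13) (.reg 10)) .skip (.arith 11 .sub (.reg 11) (.const 1))) <|
  .arith 9 .sub (.reg 11) (.reg 3)

/-! ### Correctness and cost of tree updates and searches -/

section trees

variable {S K : ℕ} {V : Set ℝ} {s : State} {Q : ℕ → State → Prop} {base L : ℕ} {f : ℕ → ℝ}

/-- Only the ancestors of a leaf depend on it, so recomputing the minima on the way to the root
repairs the tree. Each level costs nine steps and one loop test. -/
lemma wp_update (hV : ∀ k : ℕ, k ≤ K → (k : ℝ) ∈ V) (hK : S ≤ K) {j : ℕ} {v : ℝ}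
    (hS : base + 2 * 2 ^ L ≤ S) (h3 : s.reg 3 = (2 ^ L : ℕ)) (h8 : s.reg 8 = base)
    (h9 : s.reg 9 = j) (h10 : s.reg 10 = v) (hv : v ∈ V) (hj : j < 2 ^ L)
    (hT : IsTree V s.mem base (2 ^ L) f)
    (hQ : ∀ t s', t ≤ 10 * L + 4 → (∀ r < 11, s'.reg r = s.reg r) →
      (∀ i, i < base ∨ base + 2 * 2 ^ L ≤ i → s'.mem i = s.mem i) →
      IsTree V s'.mem base (2 ^ L) (Function.update f j v) → Q t s') :
    wp S V update s Q := by
  unfold update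
  generalize hm : 2 ^ L = m at *
  refine wp_seq (wp_add ((m + j : ℕ) : ℝ) (by simp [h3, h9]) (hV _ (by omega)) ?_)
  refine wp_seq (wp_add ((base + (m + j) : ℕ) : ℝ) (by simp [h8]) (hV _ (by omega)) ?_)
  refine wp_seq (wp_store (base + (m + j)) v (by simp) (by omega) (by simp [h10]) hv ?_)
  -- Only the parent `k / 2` of the node `k` reached so far may violate the minimum equation. At the
  -- root `k / 2 = 0` is not a node, so the tree is repaired.
  refine wp_loop (fun i s' => ∃ k : ℕ, 1 ≤ k ∧ k < 2 ^ (i + 1) ∧ k < 2 * m ∧ s'.reg 11 = k ∧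
    (∀ r < 11, s'.reg r = s.reg r) ∧
    (∀ i, i < base ∨ base + 2 * m ≤ i → s'.mem i = s.mem i) ∧
    (∀ l < m, s'.mem (base + (m + l)) = Function.update f j v l) ∧
    (∀ q, 1 ≤ q → q < m → q ≠ k / 2 →
      s'.mem (base + q) = min (s'.mem (base + 2 * q)) (s'.mem (base + (2 * q + 1)))) ∧
    ∀ q, 1 ≤ q → q < 2 * m → s'.mem (base + q) ∈ V) 9 ?_ L ?_ ?_
  · rintro i s₁ ⟨k, hk1, hki, hkm, h11, hreg, hmem, hleaf, hnode, hval⟩ hc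
    have hk : 1 < k := by
      simp only [holds_lt, val_const, val_reg, h11] at hc
      exact_mod_cast hc
    obtain _ | i := i
    · omega
    refine ⟨i, rfl, ?_⟩
    have h8' : s₁.reg 8 = base := by rw [hreg 8 (by norm_num), h8]
    refine wp_seq (wp_half k (by simp [h11]) (hV _ (by omega)) ?_)
    have hq1 : 1 ≤ k / 2 := by omega
    have hqm : k / 2 < m := by omega
    have hqi : k / 2 < 2 ^ (i + 1) := by rw [pow_succ] at hki; omega
    generalize k / 2 = q at *
    refine wp_seq (wp_add ((2 * q : ℕ) : ℝ) (by simp; ring) (hV _ (by omega)) ?_)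
    refine wp_seq (wp_add ((base + 2 * q : ℕ) : ℝ) (by simp [h8']) (hV _ (by omega)) ?_)
    refine wp_seq (wp_load (base + 2 * q) _ (by simp) (by omega) rfl
      (hval _ (by omega) (by omega)) ?_)
    refine wp_seq (wp_add ((base + (2 * q + 1) : ℕ) : ℝ) (by simp; ring) (hV _ (by omega)) ?_)
    refine wp_seq (wp_load (base + (2 * q + 1)) _ (by simp) (by omega) rfl
      (hval _ (by omega) (by omega)) ?_)
    refine wp_seq (wp_add ((base + q : ℕ) : ℝ) (by simp [h8']) (hV _ (by omega)) ?_)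
    have hfinal : ∀ s₂ : State, s₂.reg 11 = q → (∀ r < 11, s₂.reg r = s.reg r) →
        (∀ i, s₂.mem i = if i = base + q then
          min (s₁.mem (base + 2 * q)) (s₁.mem (base + (2 * q + 1))) else s₁.mem i) →
        ∃ k : ℕ, 1 ≤ k ∧ k < 2 ^ (i + 1) ∧ k < 2 * m ∧ s₂.reg 11 = k ∧
          (∀ r < 11, s₂.reg r = s.reg r) ∧
          (∀ i, i < base ∨ base + 2 * m ≤ i → s₂.mem i = s.mem i) ∧
          (∀ l < m, s₂.mem (base + (m + l)) = Function.update f j v l) ∧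
          (∀ q, 1 ≤ q → q < m → q ≠ k / 2 →
            s₂.mem (base + q) = min (s₂.mem (base + 2 * q)) (s₂.mem (base + (2 * q + 1)))) ∧
          ∀ q, 1 ≤ q → q < 2 * m → s₂.mem (base + q) ∈ V := by
      intro s₂ h11' hreg' hmem'
      refine ⟨q, hq1, hqi, by omega, h11', hreg', ?_, ?_, ?_, ?_⟩
      · intro i hi
        rw [hmem', if_neg (by omega), hmem i hi]
      · intro l hl
        rw [hmem', if_neg (by omega), hleaf l hl]
      · intro q' h1 h2 h3
        rcases eq_or_ne q' q with rfl | hne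
        · rw [hmem', if_pos rfl, hmem', if_neg (by omega), hmem', if_neg (by omega)]
        · rw [hmem', if_neg (by omega), hmem', if_neg (by omega), hmem', if_neg (by omega),
            hnode q' h1 h2 hne]
      · intro q' h1 h2
        rw [hmem']
        split_ifs
        · rcases min_choice (s₁.mem (base + 2 * q)) (s₁.mem (base + (2 * q + 1))) with h | h <;>
            rw [h] <;> exact hval _ (by omega) (by omega)
        · exact hval q' h1 h2
    refine wp_branch (fun hc => ?_) (fun hc => ?_)
    · refine wp_store (base + q) _ (by simp) (by omega) rfl
        (by simpa using hval _ (by omega) (by omega)) ⟨by omega, hfinal _ (by simp) ?_ ?_⟩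
      · intro r hr
        simp (disch := omega) [if_neg, hreg r hr]
      · intro i
        simp only [holds_le, val_reg, setReg_reg] at hc
        norm_num at hc
        simp [min_eq_left hc]
    · refine wp_store (base + q) _ (by simp) (by omega) rfl
        (by simpa using hval _ (by omega) (by omega)) ⟨by omega, hfinal _ (by simp) ?_ ?_⟩
      · intro r hr
        simp (disch := omega) [if_neg, hreg r hr]
      · intro i
        simp only [holds_le, val_reg, setReg_reg] at hc
        norm_num at hc
        simp [min_eq_right hc.le]
  · refine ⟨m + j, by omega, by rw [pow_succ]; omega, by omega, by simp, ?_, ?_, ?_, ?_, ?_⟩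
    · intro r hr
      simp (disch := omega) [if_neg]
    · intro i hi
      simp (disch := omega) [if_neg]
    · intro l hl
      rcases eq_or_ne l j with rfl | hne
      · simp
      · simp [hne, hT.leaf l hl]
    · intro q h1 h2 h3
      simp (disch := omega) only [setMem_mem, if_neg, setReg_mem]
      exact hT.node q h1 h2
    · intro q h1 h2
      simp only [setMem_mem, setReg_mem]
      split_ifs
      · exact hv
      · exact hT.mem_values q h1 h2
  · rintro t s₁ i ht ⟨k, hk1, hki, hkm, h11, hreg, hmem, hleaf, hnode, hval⟩ hc
    have hk : ¬ 1 < k := by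
      simp only [holds_lt, val_const, val_reg, h11] at hc
      exact_mod_cast hc
    exact hQ _ _ (by omega) hreg hmem
      ⟨hleaf, fun q h1 h2 => hnode q h1 h2 (by omega), hval⟩

/-- The descent goes right whenever the right subtree has a leaf of key at most `θ`, so everything
to the right of the path exceeds `θ`. -/
lemma wp_find (hV : ∀ k : ℕ, k ≤ K → (k : ℝ) ∈ V) (hK : S ≤ K) {θ : ℝ}
    (hS : base + 2 * 2 ^ L ≤ S) (h3 : s.reg 3 = (2 ^ L : ℕ)) (h8 : s.reg 8 = base)
    (h10 : s.reg 10 = θ) (hT : IsTree V s.mem base (2 ^ L) f) (hroot : s.mem (base + 1) ≤ θ)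
    (hQ : ∀ t (s' : State) (j : ℕ), t ≤ 7 * L + 3 → (∀ r < 11, r ≠ 9 → s'.reg r = s.reg r) → s'.mem = s.mem →
      s'.reg 9 = j → j < 2 ^ L → f j ≤ θ → (∀ l, j < l → l < 2 ^ L → θ < f l) → Q t s') :
    wp S V find s Q := by
  unfold find
  refine wp_seq (wp_add ((1 : ℕ) : ℝ) (by simp) (hV _ ?_) ?_)
  · have : 0 < 2 ^ L := by positivity
    omega
  -- The node `k` has depth `e` and lies `i` levels above the leaves, so the leaves to the right of
  -- its subtree start at number `(k + 1) * 2 ^ i`.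
  refine wp_seq (wp_loop (fun i s' => ∃ k e : ℕ, e + i = L ∧ 2 ^ e ≤ k ∧ k < 2 ^ (e + 1) ∧
    s'.reg 11 = k ∧ (∀ r < 11, s'.reg r = s.reg r) ∧ s'.mem = s.mem ∧ s.mem (base + k) ≤ θ ∧
    ∀ l, (k + 1) * 2 ^ i ≤ l → l < 2 * 2 ^ L → θ < s.mem (base + l)) 6 ?_ L ?_ ?_)
  · rintro i s₁ ⟨k, e, hei, hke, hke', h11, hreg, hmem, hkθ, hright⟩ hc
    have hk : k < 2 ^ L := by
      simp only [holds_lt, val_reg, h11, hreg 3 (by norm_num), h3] at hc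
      exact_mod_cast hc
    obtain _ | i := i
    · obtain rfl : e = L := by omega
      omega
    refine ⟨i, rfl, ?_⟩
    have hk1 : 1 ≤ k := Nat.one_le_two_pow.trans hke
    have h8' : s₁.reg 8 = base := by rw [hreg 8 (by norm_num), h8]
    have hnode := hT.node k hk1 hk
    refine wp_seq (wp_add ((2 * k : ℕ) : ℝ) (by simp [h11]; ring) (hV _ (by omega)) ?_)
    refine wp_seq (wp_add ((2 * k + 1 : ℕ) : ℝ) (by simp) (hV _ (by omega)) ?_)
    refine wp_seq (wp_add ((base + (2 * k + 1) : ℕ) : ℝ) (by simp [h8']) (hV _ (by omega)) ?_)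
    refine wp_seq (wp_load (base + (2 * k + 1)) (s.mem (base + (2 * k + 1))) (by simp) (by omega)
      (by simp [hmem]) (hT.mem_values _ (by omega) (by omega)) ?_)
    have h10' : s₁.reg 10 = θ := by rw [hreg 10 (by norm_num), h10]
    refine wp_branch (fun hc => wp_skip ?_) (fun hc => ?_)
    · simp [h10'] at hc
      refine ⟨by omega, 2 * k + 1, e + 1, by omega, by rw [pow_succ]; omega,
        by rw [pow_succ]; omega, by simp, ?_, by simp [hmem], hc, ?_⟩
      · intro r hr
        simp (disch := omega) [if_neg, hreg r hr]
      · intro l h1 h2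
        exact hright l (by rw [pow_succ]; linarith) h2
    · simp [h10'] at hc
      refine wp_sub ((2 * k : ℕ) : ℝ) (by simp) (hV _ (by omega)) ?_
      refine ⟨by omega, 2 * k, e + 1, by omega, by rw [pow_succ]; omega,
        by rw [pow_succ]; omega, by simp, ?_, by simp [hmem], ?_, ?_⟩
      · intro r hr
        simp (disch := omega) [if_neg, hreg r hr]
      · rw [hnode, min_le_iff] at hkθ
        exact hkθ.resolve_right (not_le.2 hc)
      · intro l h1 h2
        -- The leaves that newly count as right of the path lie below the rejected right child,
        -- whose minimum exceeds `θ`.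
        rcases lt_or_ge l ((k + 1) * 2 ^ (i + 1)) with h | h
        · exact hc.trans_le (hT.le_descendant i (2 * k + 1) l (by omega) h1
            (by rw [pow_succ] at h; linarith) h2)
        · exact hright l h h2
  · refine ⟨1, 0, by omega, by simp, by simp, by simp, ?_, rfl, hroot, ?_⟩
    · intro r hr
      simp (disch := omega) [if_neg]
    · intro l h1 h2
      omega
  · rintro t s₁ i ht ⟨k, e, hei, hke, hke', h11, hreg, hmem, hkθ, hright⟩ hc
    have h3' : s₁.reg 3 = (2 ^ L : ℕ) := by rw [hreg 3 (by norm_num), h3]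
    have hk : 2 ^ L ≤ k := by
      simp only [holds_lt, val_reg, h11, h3'] at hc
      exact_mod_cast not_lt.1 hc
    have he : e = L := by
      have := (Nat.pow_lt_pow_iff_right (by norm_num : 1 < 2)).1 (hk.trans_lt hke')
      omega
    subst he
    obtain rfl : i = 0 := by omega
    obtain ⟨j, rfl⟩ := Nat.exists_eq_add_of_le hk
    rw [pow_succ] at hke'
    refine wp_sub ((j : ℕ) : ℝ) (by simp [h11, h3']) (hV _ (by omega)) ?_
    refine hQ _ _ j (by omega) ?_ (by simp [hmem]) (by simp) (by omega) ?_ ?_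
    · intro r hr hr9
      simp (disch := omega) [if_neg, hreg r hr]
    · rwa [← hT.leaf j (by omega)]
    · intro l h1 h2
      rw [← hT.leaf l h2]
      exact hright _ (by omega) (by omega)

end trees
/-! ### Queries -/

/-- Set leaf `R[9]` of the tree at `R[5]` to the same leaf of the tree at `R[4]`, reduced by `R[2]`
and cut off at `0`. -/
def sync : Prog :=
  .seq (.arith 8 .add (.reg 4) (.reg 3)) <|
  .seq (.arith 8 .add (.reg 8) (.reg 9)) <|
  .seq (.load 10 (.reg 8)) <|
  .seq (.arith 10 .sub (.reg 10) (.reg 2)) <|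
  .seq (.branch (.lt (.reg 10) (.const 0)) (.arith 10 .add (.const 0) (.const 0)) .skip) <|
  .seq (.arith 8 .add (.reg 5) (.const 0))
  update

/-- Report and trim the bamboo at the last position whose key is at most the clock `R[6]`. -/
def trim : Prog :=
  .seq (.arith 0 .add (.const 0) (.const 0)) <|
  .seq (.arith 8 .add (.reg 4) (.const 0)) <|
  .seq (.arith 12 .add (.reg 8) (.const 1)) <|
  .seq (.load 13 (.reg 12)) <|
  .branch (.le (.reg 13) (.reg 6))
    (.seq (.arith 10 .add (.reg 6) (.const 0)) <|
    .seq find <|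
    .seq (.arith 11 .add (.reg 2) (.reg 2)) <|
    .seq (.arith 11 .add (.reg 11) (.reg 9)) <|
    .seq (.load 0 (.reg 11)) <|
    .seq (.arith 11 .add (.reg 2) (.reg 9)) <|
    .seq (.load 10 (.reg 11)) <|
    .seq (.arith 10 .add (.reg 10) (.reg 6)) <|
    .seq update sync)
    .skip

/-- Advance the clock `R[6]`, and exchange the two trees at the end of an epoch of `R[2]` days. -/
def tick : Prog :=
  .branch (.lt (.reg 6) (.reg 2))
    (.arith 6 .add (.reg 6) (.const 1))
    (.seq (.arith 6 .add (.const 1) (.const 0)) <|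
    .seq (.arith 11 .add (.reg 4) (.const 0)) <|
    .seq (.arith 4 .add (.reg 5) (.const 0))
    (.arith 5 .add (.reg 11) (.const 0)))

/-- The clock value `τ` selects position `τ - 1` for the background copy, so one epoch visits every
position. -/
def query : Prog :=
  .seq trim <| .seq (.arith 9 .sub (.reg 6) (.const 1)) <| .seq sync tick

/-- The sizes that the data structure depends on: at most `n` bamboos, trees with `2 ^ L` leaves,
waiting times at most `P`, memory of size `S`, and integers up to `K`, all of them in `V`. -/
structure Sizes (V : Set ℝ) (n L P S K : ℕ) : Prop where
  le_leaves : n ≤ 2 ^ L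
  memory : 3 * n + 4 * 2 ^ L ≤ S
  memory_le : S ≤ K
  time_le : n + P + 1 ≤ K
  int_mem : ∀ z : ℤ, |z| ≤ K → (z : ℝ) ∈ V

lemma Sizes.nat_mem {V : Set ℝ} {n L P S K : ℕ} (h : Sizes V n L P S K) (k : ℕ) (hk : k ≤ K) :
    (k : ℝ) ∈ V := by
  simpa using h.int_mem k (by simpa using hk)

/-- The data structure in the tree bases `a`, `b` with clock `τ`: position `j` has the waiting time
`p j`, belongs to bamboo `c j`, and has the key `κ j`; the tree at `b` has the leaves `g`. -/
structure Stored (V : Set ℝ) (n L P S : ℕ) (p c : ℕ → ℕ) (s : State) (a b τ : ℕ) (κ : ℕ → ℕ)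
    (g : ℕ → ℝ) : Prop where
  reg_n : s.reg 2 = n
  reg_m : s.reg 3 = (2 ^ L : ℕ)
  reg_a : s.reg 4 = a
  reg_b : s.reg 5 = b
  reg_clock : s.reg 6 = τ
  le_a : 3 * n ≤ a
  le_b : 3 * n ≤ b
  a_le : a + 2 * 2 ^ L ≤ S
  b_le : b + 2 * 2 ^ L ≤ S
  disjoint : a + 2 * 2 ^ L ≤ b ∨ b + 2 * 2 ^ L ≤ a
  clock_pos : 1 ≤ τ
  clock_le : τ ≤ n
  wait : ∀ j < n, s.mem (n + j) = p j
  wait_le : ∀ j < n, p j ≤ P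
  wait_pos : ∀ j < n, 1 ≤ p j
  name : ∀ j < n, s.mem (2 * n + j) = (c j + 1 : ℕ)
  name_lt : ∀ j < n, c j < n
  tree_a : IsTree V s.mem a (2 ^ L) fun j => κ j
  tree_b : IsTree V s.mem b (2 ^ L) g
  key_le : ∀ j < n, κ j ≤ n + P
  -- The clock never exceeds `n`, so a padding key `n + 1` is never ready.
  pad_a : ∀ j, n ≤ j → j < 2 ^ L → κ j = n + 1
  pad_b : ∀ j, n ≤ j → j < 2 ^ L → g j = (n + 1 : ℕ)

/-! ### Correctness and cost of a single query -/

section queries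

variable {V : Set ℝ} {n L P S K : ℕ} {p c : ℕ → ℕ} {s : State} {a b τ : ℕ} {κ : ℕ → ℕ}
  {g : ℕ → ℝ} {Q : ℕ → State → Prop}

/-- The truncated subtraction `κ j - n` expresses both the shift to the next epoch and the cut-off
at `0`. -/
lemma wp_sync (hs : Sizes V n L P S K) (h : Stored V n L P S p c s a b τ κ g) {j : ℕ}
    (hj : j < n) (h9 : s.reg 9 = j)
    (hQ : ∀ t s', t ≤ 10 * L + 12 → s'.reg 0 = s.reg 0 →
      Stored V n L P S p c s' a b τ κ (Function.update g j ((κ j - n : ℕ) : ℝ)) → Q t s') :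
    wp S V sync s Q := by
  have hle := hs.le_leaves
  have hmem := hs.memory
  have hSK := hs.memory_le
  have hK := hs.time_le
  have h1 := h.a_le
  have h2 := h.b_le
  have h3 := h.key_le j hj
  unfold sync
  refine wp_seq (wp_add ((a + 2 ^ L : ℕ) : ℝ) (by simp [h.reg_a, h.reg_m])
    (hs.nat_mem _ (by omega)) ?_)
  refine wp_seq (wp_add ((a + (2 ^ L + j) : ℕ) : ℝ) (by simp [h9]; ring)
    (hs.nat_mem _ (by omega)) ?_)
  refine wp_seq (wp_load (a + (2 ^ L + j)) (κ j) (by simp) (by omega)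
    (by simpa using h.tree_a.leaf j (by omega)) (hs.nat_mem _ (by omega)) ?_)
  -- Before the cut-off the difference may be negative, which is why `Sizes.int_mem` speaks of
  -- integers.
  refine wp_seq (wp_sub (((κ j : ℤ) - n : ℤ) : ℝ) (by simp [h.reg_n])
    (hs.int_mem _ (by rw [abs_le]; omega)) ?_)
  have key : ∀ t s₁, t ≤ 6 → (∀ r < 10, r ≠ 8 → s₁.reg r = s.reg r) → s₁.mem = s.mem →
      s₁.reg 10 = ((κ j - n : ℕ) : ℝ) →
      wp S V (.seq (.arith 8 .add (.reg 5) (.const 0)) update) s₁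
        (fun t' s'' => Q (t + t') s'') := by
    intro t s₁ ht hreg hm h10
    refine wp_seq (wp_add (b : ℝ) (by simp [hreg, h.reg_b]) (hs.nat_mem _ (by omega)) ?_)
    refine wp_update (hs.nat_mem) hSK h2 (by simp [hreg, h.reg_m]) (by simp)
      (j := j) (by simp [hreg, h9]) (by simp [h10]; rfl) (hs.nat_mem _ (by omega)) (by omega)
      (by simpa [hm] using h.tree_b) ?_
    intro t' s₂ ht' hreg' hm' hT
    have hr : ∀ r < 8, s₂.reg r = s.reg r := by
      intro r hr
      rw [hreg' r (by omega)]
      simp (disch := omega) [if_neg, hreg]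
    have hm'' : ∀ i, i < b ∨ b + 2 * 2 ^ L ≤ i → s₂.mem i = s.mem i := by
      intro i hi
      rw [hm' i hi, setReg_mem, hm]
    have h4 := h.le_b
    refine hQ _ _ (by omega) (hr 0 (by norm_num)) { h with
      reg_n := by rw [hr _ (by norm_num), h.reg_n]
      reg_m := by rw [hr _ (by norm_num), h.reg_m]
      reg_a := by rw [hr _ (by norm_num), h.reg_a]
      reg_b := by rw [hr _ (by norm_num), h.reg_b]
      reg_clock := by rw [hr _ (by norm_num), h.reg_clock]
      wait := fun i hi => by rw [hm'' _ (by omega), h.wait i hi]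
      name := fun i hi => by rw [hm'' _ (by omega), h.name i hi]
      tree_a := h.tree_a.congr (fun i _ _ => hm'' i (by have := h.disjoint; omega)) fun _ _ => rfl
      tree_b := hT
      pad_b := fun i hi hi' => by
        rw [Function.update_of_ne (by omega), h.pad_b i hi hi'] }
  refine wp_seq (wp_branch (fun hc => ?_) (fun hc => wp_skip ?_))
  · have hlt : κ j < n := by simpa using hc
    refine wp_add ((0 : ℕ) : ℝ) (by simp) (hs.nat_mem _ (by omega)) ?_
    have := key 6
    simp only [← add_assoc] at this ⊢
    refine this _ le_rfl ?_ (by simp) (by simp [Nat.sub_eq_zero_of_le hlt.le])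
    intro r hr hr8
    simp (disch := omega) [if_neg]
  · have hle' : n ≤ κ j := by simpa using hc
    have := key 6
    simp only [← add_assoc] at this ⊢
    refine this _ le_rfl ?_ (by simp) (by simp [Nat.cast_sub hle'])
    intro r hr hr8
    simp (disch := omega) [if_neg]

/-- The position that is trimmed if the position `j` has the waiting time `p j` and has grown for
`e j` days: the last one that has waited long enough. -/
def IsChoice (n : ℕ) (p e : ℕ → ℕ) : Option ℕ → Prop
  | none => ∀ j < n, e j < p j
  | some k => k < n ∧ p k ≤ e k ∧ ∀ j, k < j → j < n → e j < p j

/-- Number of days for which the position `j` has grown at the end of the next day. -/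
def nextAge (e : ℕ → ℕ) (o : Option ℕ) (j : ℕ) : ℕ :=
  if o = some j then 1 else e j + 1

def answer (c : ℕ → ℕ) : Option ℕ → ℝ
  | none => 0
  | some k => (c k + 1 : ℕ)

/-- By `hage`, `κ j ≤ τ` is equivalent to `p j ≤ e j`, so `find` with the clock as threshold returns
the position to trim. Its new key is `p k + τ`. The trimmed position is also entered in the second
tree, since it may have been copied earlier in the epoch. The `27` per level is one search and two
updates. -/
lemma wp_trim (hs : Sizes V n L P S K) (h : Stored V n L P S p c s a b τ κ g) {e : ℕ → ℕ}
    (hsync : ∀ j < τ - 1, g j = (κ j - n : ℕ)) (hage : ∀ j < n, κ j - τ = p j - e j)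
    (hQ : ∀ t s' o κ' g', t ≤ 27 * L + 100 → IsChoice n p e o → s'.reg 0 = answer c o →
      Stored V n L P S p c s' a b τ κ' g' → (∀ j < τ - 1, g' j = (κ' j - n : ℕ)) →
      (∀ j < n, κ' j - (τ + 1) = p j - nextAge e o j) → Q t s') :
    wp S V trim s Q := by
  have hle := hs.le_leaves
  have hmem := hs.memory
  have hSK := hs.memory_le
  have hK := hs.time_le
  have h1 := h.a_le
  have h2 := h.b_le
  have h3 := h.clock_le
  have hτ := h.clock_pos
  unfold trim
  refine wp_seq (wp_add ((0 : ℕ) : ℝ) (by simp) (hs.nat_mem _ (by omega)) ?_)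
  refine wp_seq (wp_add (a : ℝ) (by simp [h.reg_a]) (hs.nat_mem _ (by omega)) ?_)
  refine wp_seq (wp_add ((a + 1 : ℕ) : ℝ) (by simp) (hs.nat_mem _ (by omega)) ?_)
  refine wp_seq (wp_load (a + 1) _ (by simp) (by omega) rfl
    (by simpa using h.tree_a.mem_values 1 le_rfl (by omega)) ?_)
  refine wp_branch (fun hc => ?_) (fun hc => wp_skip ?_)
  · simp [h.reg_clock] at hc
    refine wp_seq (wp_add (τ : ℝ) (by simp [h.reg_clock]) (hs.nat_mem _ (by omega)) ?_)
    refine wp_seq (wp_find hs.nat_mem hSK (base := a) (L := L) h1 (by simp [h.reg_m]) (by simp)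
      (by simp; rfl) (by simpa using h.tree_a) (by simpa using hc) ?_)
    intro t₁ s₁ k ht₁ hreg₁ hmem₁ h9₁ hkL hkτ hright
    have hr₁ : ∀ r < 8, r ≠ 0 → s₁.reg r = s.reg r := by
      intro r hr hr0
      rw [hreg₁ r (by omega) (by omega)]
      simp (disch := omega) [if_neg]
    have hm₁ : s₁.mem = s.mem := by simpa using hmem₁
    have h8₁ : s₁.reg 8 = a := by simp [hreg₁]
    have hkτ' : κ k ≤ τ := by exact_mod_cast hkτ
    -- A padding leaf has key `n + 1 > τ`, so the leaf found belongs to a bamboo.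
    have hkn : k < n := by
      by_contra hk
      have := h.pad_a k (by omega) hkL
      omega
    have hright' : ∀ l, k < l → l < n → τ < κ l := fun l hl hl' => by
      exact_mod_cast hright l hl (by omega)
    have hc' := h.name_lt k hkn
    have hp := h.wait_le k hkn
    have hp1 := h.wait_pos k hkn
    refine wp_seq (wp_add ((2 * n : ℕ) : ℝ) (by simp [hr₁, h.reg_n]; ring)
      (hs.nat_mem _ (by omega)) ?_)
    refine wp_seq (wp_add ((2 * n + k : ℕ) : ℝ) (by simp [h9₁]) (hs.nat_mem _ (by omega)) ?_)
    refine wp_seq (wp_load (2 * n + k) ((c k + 1 : ℕ) : ℝ) (by simp) (by omega)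
      (by simpa [hm₁] using h.name k hkn) (hs.nat_mem _ (by omega)) ?_)
    refine wp_seq (wp_add ((n + k : ℕ) : ℝ) (by simp [h9₁, hr₁, h.reg_n])
      (hs.nat_mem _ (by omega)) ?_)
    refine wp_seq (wp_load (n + k) (p k) (by simp) (by omega)
      (by simpa [hm₁] using h.wait k hkn) (hs.nat_mem _ (by omega)) ?_)
    refine wp_seq (wp_add ((p k + τ : ℕ) : ℝ) (by simp [hr₁, h.reg_clock])
      (hs.nat_mem _ (by omega)) ?_)
    refine wp_seq (wp_update hs.nat_mem hSK (base := a) (L := L) (j := k) h1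
      (by simp [hr₁, h.reg_m]) (by simp [h8₁]) (by simp [h9₁]) (by simp; rfl)
      (by simpa using hs.nat_mem (p k + τ) (by omega)) hkL (by simpa [hm₁] using h.tree_a) ?_)
    intro t₂ s₂ ht₂ hreg₂ hmem₂ hT
    have hr₂ : ∀ r < 8, r ≠ 0 → s₂.reg r = s.reg r := by
      intro r hr hr0
      rw [hreg₂ r (by omega)]
      simp (disch := omega) [if_neg, hr₁]
    have hm₂ : ∀ i, i < a ∨ a + 2 * 2 ^ L ≤ i → s₂.mem i = s.mem i := by
      intro i hi
      rw [hmem₂ i hi]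
      simp [hm₁]
    have h9₂ : s₂.reg 9 = k := by
      rw [hreg₂ 9 (by norm_num)]
      simp [h9₁]
    have h0₂ : s₂.reg 0 = (c k + 1 : ℕ) := by
      rw [hreg₂ 0 (by norm_num)]
      simp
    have h4 := h.le_a
    refine wp_sync (κ := Function.update κ k (p k + τ)) (g := g) hs { h with
      reg_n := by rw [hr₂ _ (by norm_num) (by norm_num), h.reg_n]
      reg_m := by rw [hr₂ _ (by norm_num) (by norm_num), h.reg_m]
      reg_a := by rw [hr₂ _ (by norm_num) (by norm_num), h.reg_a]
      reg_b := by rw [hr₂ _ (by norm_num) (by norm_num), h.reg_b]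
      reg_clock := by rw [hr₂ _ (by norm_num) (by norm_num), h.reg_clock]
      wait := fun i hi => by rw [hm₂ _ (by omega), h.wait i hi]
      name := fun i hi => by rw [hm₂ _ (by omega), h.name i hi]
      tree_a := hT.congr (fun _ _ _ => rfl) fun i _ => by
        simp only [Function.update_apply]
        split_ifs <;> simp
      tree_b := h.tree_b.congr (fun i _ _ => hm₂ i (by have := h.disjoint; omega)) fun _ _ => rfl
      key_le := fun i hi => by
        rw [Function.update_apply]
        split_ifs
        · omega
        · exact h.key_le i hi
      pad_a := fun i hi hi' => by
        rw [Function.update_of_ne (by omega), h.pad_a i hi hi'] } hkn h9₂ ?_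
    intro t₃ s₃ ht₃ h0₃ h₃
    refine hQ _ s₃ (some k) _ _ ?_ ?_ (by rw [h0₃, h0₂, answer]) h₃ ?_ ?_
    · omega
    · refine ⟨hkn, ?_, fun l hl hl' => ?_⟩
      · have := hage k hkn
        omega
      · have := hage l hl'
        have := hright' l hl hl'
        omega
    · intro i hi
      rcases eq_or_ne i k with rfl | hne
      · simp
      · simp [hne, hsync i hi]
    · intro i hi
      have := hage i hi
      rcases eq_or_ne i k with rfl | hne
      · simp [nextAge]
        omega
      · simp [nextAge, hne, hne.symm]
        omega
  · simp [h.reg_clock] at hc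
    have hall : ∀ j < n, τ < κ j := fun j hj => by
      exact_mod_cast hc.trans_le (h.tree_a.root_le (j := j) (by omega))
    refine hQ _ _ none κ g (by omega) ?_ (by simp [answer]) { h with
      reg_n := by simp [h.reg_n]
      reg_m := by simp [h.reg_m]
      reg_a := by simp [h.reg_a]
      reg_b := by simp [h.reg_b]
      reg_clock := by simp [h.reg_clock] } hsync ?_
    · intro j hj
      have := hage j hj
      have := hall j hj
      omega
    · intro j hj
      have := hage j hj
      simp [nextAge]
      omega

/-- The invariant of the queries; position `j` has grown for `e j` days. -/
def Ready (V : Set ℝ) (n L P S : ℕ) (p c : ℕ → ℕ) (s : State) (e : ℕ → ℕ) : Prop :=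
  ∃ a b τ κ g, Stored V n L P S p c s a b τ κ g ∧ (∀ j < τ - 1, g j = (κ j - n : ℕ)) ∧
    ∀ j < n, κ j - τ = p j - e j

/-- The daily copy extends the synchronised prefix from `τ - 1` to `τ` positions. When `τ = n` the
prefix is everything, and restarting the clock at `1` preserves all waits because `(κ j - n) - 1 = κ
j - (n + 1)`. -/
lemma wp_query (hs : Sizes V n L P S K) {e : ℕ → ℕ} (h : Ready V n L P S p c s e) :
    wp S V query s fun t s' => t ≤ 37 * L + 120 ∧ ∃ o, IsChoice n p e o ∧
      s'.reg 0 = answer c o ∧ Ready V n L P S p c s' (nextAge e o) := by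
  obtain ⟨a, b, τ, κ, g, h, hsync, hage⟩ := h
  have hle := hs.le_leaves
  have hmem := hs.memory
  have hSK := hs.memory_le
  have hK := hs.time_le
  have h3 := h.clock_le
  have hτ := h.clock_pos
  unfold query
  refine wp_seq (wp_trim hs h hsync hage ?_)
  clear h hsync hage
  intro t₁ s₁ o κ g ht₁ ho h0 h hsync hage
  refine wp_seq (wp_sub ((τ - 1 : ℕ) : ℝ) (by simp [h.reg_clock, Nat.cast_sub hτ])
    (hs.nat_mem _ (by omega)) ?_)
  refine wp_seq (wp_sync (κ := κ) (g := g) (a := a) (b := b) (τ := τ) (p := p) (c := c) hs { h with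
      reg_n := by simp [h.reg_n]
      reg_m := by simp [h.reg_m]
      reg_a := by simp [h.reg_a]
      reg_b := by simp [h.reg_b]
      reg_clock := by simp [h.reg_clock] } (j := τ - 1) (by omega) (by simp) ?_)
  intro t₂ s₂ ht₂ h0' h₂
  replace h0' : s₂.reg 0 = answer c o := by rw [h0', ← h0]; simp
  have hsync' : ∀ j < τ, Function.update g (τ - 1) ((κ (τ - 1) - n : ℕ) : ℝ) j
      = (κ j - n : ℕ) := by
    intro j hj
    rcases eq_or_ne j (τ - 1) with rfl | hne
    · simp
    · rw [Function.update_of_ne hne, hsync j (by omega)]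
  clear hsync h
  generalize Function.update g (τ - 1) ((κ (τ - 1) - n : ℕ) : ℝ) = g' at *
  unfold tick
  refine wp_branch (fun hc => ?_) (fun hc => ?_)
  · have hlt : τ < n := by simpa [h₂.reg_clock, h₂.reg_n] using hc
    refine wp_add ((τ + 1 : ℕ) : ℝ) (by simp [h₂.reg_clock]) (hs.nat_mem _ (by omega)) ?_
    refine ⟨by omega, o, ho, by simp [h0'], a, b, τ + 1, κ, g', { h₂ with
      reg_n := by simp [h₂.reg_n]
      reg_m := by simp [h₂.reg_m]
      reg_a := by simp [h₂.reg_a]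
      reg_b := by simp [h₂.reg_b]
      reg_clock := by simp
      clock_pos := by omega
      clock_le := hlt }, hsync', hage⟩
  · have heq : τ = n := le_antisymm h3 (by simpa [h₂.reg_clock, h₂.reg_n] using hc)
    have ha := h₂.a_le
    have hb := h₂.b_le
    refine wp_seq (wp_add ((1 : ℕ) : ℝ) (by simp) (hs.nat_mem _ (by omega)) ?_)
    refine wp_seq (wp_add (a : ℝ) (by simp [h₂.reg_a]) (hs.nat_mem _ (by omega)) ?_)
    refine wp_seq (wp_add (b : ℝ) (by simp [h₂.reg_b]) (hs.nat_mem _ (by omega)) ?_)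
    refine wp_add (a : ℝ) (by simp) (hs.nat_mem _ (by omega)) ?_
    -- Padding keys are not shifted: no copy ever touches them, and they are `n + 1` in both trees.
    -- The old first tree may serve as it is, since nothing need be synchronised at clock `1`.
    refine ⟨by omega, o, ho, by simp [h0'], b, a, 1,
      fun j => if j < n then κ j - n else n + 1, fun j => κ j, { h₂ with
      reg_n := by simp [h₂.reg_n]
      reg_m := by simp [h₂.reg_m]
      reg_a := by simp
      reg_b := by simp
      reg_clock := by simp
      clock_pos := by omega
      clock_le := by omega
      le_a := h₂.le_b
      le_b := h₂.le_a
      a_le := hb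
      b_le := ha
      disjoint := h₂.disjoint.symm
      tree_a := h₂.tree_b.congr (fun _ _ _ => by simp) fun j hj => by
        split_ifs with hjn
        · exact (hsync' j (by omega)).symm
        · exact (h₂.pad_b j (by omega) hj).symm
      tree_b := h₂.tree_a
      key_le := fun j hj => by
        have := h₂.key_le j hj
        simp only [hj, if_true]
        omega
      pad_a := fun j hj _ => by simp [hj.not_gt]
      pad_b := fun j hj hj' => by rw [h₂.pad_a j hj hj'] }, by simp, ?_⟩
    intro j hj
    have := hage j hj
    simp only [hj, if_true]
    omega

end queries
/-! ### Building the data structure -/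

/-- Copy `n` to `R[2]`, and compute the number `R[3]` of leaves and the tree bases `R[4]`, `R[5]`. -/
def setup : Prog :=
  .seq (.arith 2 .add (.reg 0) (.const 0)) <|
  .seq (.arith 3 .add (.const 1) (.const 0)) <|
  .seq (.loop (.lt (.reg 3) (.reg 2)) (.arith 3 .add (.reg 3) (.reg 3))) <|
  .seq (.arith 4 .add (.reg 2) (.reg 2)) <|
  .seq (.arith 4 .add (.reg 4) (.reg 2)) <|
  .seq (.arith 5 .add (.reg 4) (.reg 3))
  (.arith 5 .add (.reg 5) (.reg 3))

/-- Set all leaves of both trees to `n + 1`. -/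
def blank : Prog :=
  .seq (.arith 7 .add (.const 0) (.const 0)) <|
  .loop (.lt (.reg 7) (.reg 3)) <|
    .seq (.arith 9 .add (.reg 7) (.const 0)) <|
    .seq (.arith 10 .add (.reg 2) (.const 1)) <|
    .seq (.arith 8 .add (.reg 4) (.const 0)) <|
    .seq update <|
    .seq (.arith 8 .add (.reg 5) (.const 0)) <|
    .seq update
    (.arith 7 .add (.reg 7) (.const 1))

/-- Enter the growth rates into the second tree. -/
def enter : Prog :=
  .seq (.arith 7 .add (.const 0) (.const 0)) <|
  .loop (.lt (.reg 7) (.reg 2)) <|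
    .seq (.arith 9 .add (.reg 7) (.const 0)) <|
    .seq (.load 10 (.reg 7)) <|
    .seq (.arith 8 .add (.reg 5) (.const 0)) <|
    .seq update
    (.arith 7 .add (.reg 7) (.const 1))

/-- Extract the bamboos from the second tree in the order of their growth rates, and write down
their names and waiting times. -/
def rank : Prog :=
  .seq (.arith 7 .add (.const 0) (.const 0)) <|
  .loop (.lt (.reg 7) (.reg 2)) <|
    .seq (.arith 8 .add (.reg 5) (.const 0)) <|
    .seq (.arith 12 .add (.reg 8) (.const 1)) <|
    .seq (.load 10 (.reg 12)) <|
    .seq find <|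
    .seq (.arith 10 .add (.reg 2) (.const 1)) <|
    .seq update <|
    .seq (.load 11 (.reg 9)) <|
    .seq (.arith 10 .ceilDiv (.reg 1) (.reg 11)) <|
    .seq (.arith 11 .add (.reg 2) (.reg 7)) <|
    .seq (.store (.reg 11) (.reg 10)) <|
    .seq (.arith 11 .add (.reg 11) (.reg 2)) <|
    .seq (.arith 12 .add (.reg 9) (.const 1)) <|
    .seq (.store (.reg 11) (.reg 12)) <|
    .seq (.arith 9 .add (.reg 7) (.const 0)) <|
    .seq (.arith 8 .add (.reg 4) (.const 0)) <|
    .seq update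
    (.arith 7 .add (.reg 7) (.const 1))

def build : Prog :=
  .seq setup <| .seq blank <| .seq enter <| .seq rank (.arith 6 .add (.const 1) (.const 0))

/-- The registers after `setup`, and the input rates in memory. -/
structure Prepared (n L : ℕ) (x : ℝ) (h : ℕ → ℝ) (s : State) : Prop where
  reg_x : s.reg 1 = x
  reg_n : s.reg 2 = n
  reg_m : s.reg 3 = (2 ^ L : ℕ)
  reg_a : s.reg 4 = (3 * n : ℕ)
  reg_b : s.reg 5 = (3 * n + 2 * 2 ^ L : ℕ)
  rate : ∀ i < n, s.mem i = h i

lemma Prepared.congr {n L : ℕ} {x : ℝ} {h : ℕ → ℝ} {s s' : State} (hp : Prepared n L x h s)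
    (hreg : ∀ r, 1 ≤ r → r ≤ 5 → s'.reg r = s.reg r) (hmem : ∀ i < n, s'.mem i = s.mem i) :
    Prepared n L x h s' where
  reg_x := by rw [hreg 1 (by norm_num) (by norm_num), hp.reg_x]
  reg_n := by rw [hreg 2 (by norm_num) (by norm_num), hp.reg_n]
  reg_m := by rw [hreg 3 (by norm_num) (by norm_num), hp.reg_m]
  reg_a := by rw [hreg 4 (by norm_num) (by norm_num), hp.reg_a]
  reg_b := by rw [hreg 5 (by norm_num) (by norm_num), hp.reg_b]
  rate i hi := by rw [hmem i hi, hp.rate i hi]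

/-- Rates with their waiting times for the threshold `x`. -/
structure Rates (V : Set ℝ) (n P : ℕ) (x : ℝ) (h : ℕ → ℝ) : Prop where
  pos : ∀ i < n, 0 < h i
  le_one : ∀ i < n, h i ≤ 1
  mem_values : ∀ i < n, h i ∈ V
  x_pos : 0 < x
  ceil_le : ∀ i < n, ⌈x / h i⌉₊ ≤ P

/-- Bamboo `i` grows slower than `k`, or as fast as `k` and comes later in the input. -/
def Slower (h : ℕ → ℝ) (i k : ℕ) : Prop := h i < h k ∨ h i = h k ∧ k < i

lemma Slower.ne {h : ℕ → ℝ} {i k : ℕ} (hs : Slower h i k) : i ≠ k := by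
  rintro rfl
  rcases hs with hs | hs
  · exact lt_irrefl _ hs
  · exact lt_irrefl _ hs.2

/-! ### Correctness and cost of the construction -/

section building

variable {V : Set ℝ} {n L P S K : ℕ} {x : ℝ} {h : ℕ → ℝ} {s : State} {Q : ℕ → State → Prop}

lemma wp_ceilDiv {dst : ℕ} {u v : Operand} (k : ℕ) (hv : 0 < v.val s) (hu : 0 ≤ u.val s)
    (hk : ⌈u.val s / v.val s⌉₊ = k) (hV : (k : ℝ) ∈ V) (hQ : Q 1 (s.setReg dst k)) :
    wp S V (.arith dst .ceilDiv u v) s Q := by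
  refine wp_arith _ hv.ne' ?_ hV hQ
  rw [← hk]
  exact (natCast_ceil_eq_intCast_ceil (by positivity)).symm

lemma wp_setup (hs : Sizes V n (Nat.clog 2 n) P S K) (h0 : s.reg 0 = n) (h1 : s.reg 1 = x)
    (hm : ∀ i < n, s.mem i = h i)
    (hQ : ∀ t s', t ≤ 2 * Nat.clog 2 n + 7 → s'.mem = s.mem →
      Prepared n (Nat.clog 2 n) x h s' → Q t s') : wp S V setup s Q := by
  have hmem := hs.memory
  have hSK := hs.memory_le
  have hK := hs.time_le
  unfold setup
  generalize hL : Nat.clog 2 n = L at *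
  refine wp_seq (wp_add (n : ℝ) (by simp [h0]) (hs.nat_mem _ (by omega)) ?_)
  refine wp_seq (wp_add ((1 : ℕ) : ℝ) (by simp) (hs.nat_mem _ (by omega)) ?_)
  refine wp_seq (wp_loop (fun i s' => ∃ e, e + i = L ∧ s'.reg 3 = (2 ^ e : ℕ) ∧ s'.reg 1 = x ∧
    s'.reg 2 = n ∧ s'.mem = s.mem) 1 ?_ L ?_ ?_)
  · rintro i s₁ ⟨e, hei, hr3, hr1, hr2, hmm⟩ hc
    have hlt : 2 ^ e < n := by
      simp only [holds_lt, val_reg, hr3, hr2] at hc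
      exact_mod_cast hc
    have he : e < L := by
      rw [← hL]
      exact (Nat.lt_clog_iff_pow_lt (by norm_num)).2 hlt
    have hle : 2 ^ (e + 1) ≤ 2 ^ L := Nat.pow_le_pow_right (by norm_num) he
    refine ⟨i - 1, by omega, ?_⟩
    refine wp_add ((2 ^ (e + 1) : ℕ) : ℝ) (by simp [hr3]; ring) (hs.nat_mem _ (by omega)) ?_
    exact ⟨le_rfl, e + 1, by omega, by simp, by simp [hr1], by simp [hr2], by simp [hmm]⟩
  · exact ⟨0, by omega, by simp, by simp [h1], by simp, by simp⟩
  · rintro t s₁ i ht ⟨e, hei, hr3, hr1, hr2, hmm⟩ hc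
    have hle : n ≤ 2 ^ e := by
      simp only [holds_lt, val_reg, hr3, hr2, not_lt] at hc
      exact_mod_cast hc
    have he : L ≤ e := by
      rw [← hL]
      exact Nat.clog_le_of_le_pow hle
    obtain rfl : e = L := by omega
    refine wp_seq (wp_add ((2 * n : ℕ) : ℝ) (by simp [hr2]; ring) (hs.nat_mem _ (by omega)) ?_)
    refine wp_seq (wp_add ((3 * n : ℕ) : ℝ) (by simp [hr2]; ring) (hs.nat_mem _ (by omega)) ?_)
    refine wp_seq (wp_add ((3 * n + 2 ^ e : ℕ) : ℝ) (by simp [hr3]) (hs.nat_mem _ (by omega)) ?_)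
    refine wp_add ((3 * n + 2 * 2 ^ e : ℕ) : ℝ) (by simp [hr3]; ring)
      (hs.nat_mem _ (by omega)) ?_
    refine hQ _ _ (by omega) (by simp [hmm]) ⟨?_, ?_, ?_, ?_, ?_, ?_⟩
    · simp [hr1]
    · simp [hr2]
    · simp [hr3]
    · simp
    · simp
    · intro i hi
      simp [hmm, hm i hi]

lemma wp_blank (hs : Sizes V n L P S K) (hp : Prepared n L x h s)
    (hz : ∀ i, n ≤ i → s.mem i = 0)
    (hQ : ∀ t s' f g, t ≤ 2 ^ L * (20 * L + 14) + 2 → Prepared n L x h s' →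
      IsTree V s'.mem (3 * n) (2 ^ L) f → IsTree V s'.mem (3 * n + 2 * 2 ^ L) (2 ^ L) g →
      (∀ j < 2 ^ L, f j = (n + 1 : ℕ)) → (∀ j < 2 ^ L, g j = (n + 1 : ℕ)) → Q t s') :
    wp S V blank s Q := by
  have hmem := hs.memory
  have hSK := hs.memory_le
  have hK := hs.time_le
  have hle := hs.le_leaves
  unfold blank
  refine wp_seq (wp_add ((0 : ℕ) : ℝ) (by simp) (hs.nat_mem _ (by omega)) ?_)
  refine wp_loop (fun i s' => ∃ j f g, j + i = 2 ^ L ∧ s'.reg 7 = (j : ℕ) ∧ Prepared n L x h s' ∧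
    IsTree V s'.mem (3 * n) (2 ^ L) f ∧ IsTree V s'.mem (3 * n + 2 * 2 ^ L) (2 ^ L) g ∧
    (∀ l < j, f l = (n + 1 : ℕ)) ∧ ∀ l < j, g l = (n + 1 : ℕ)) (20 * L + 13) ?_ (2 ^ L) ?_ ?_
  · rintro i s₁ ⟨j, f, g, hji, h7, hp₁, hf, hg, hfj, hgj⟩ hc
    have hj : j < 2 ^ L := by
      simp only [holds_lt, val_reg, hp₁.reg_m, h7] at hc
      exact_mod_cast hc
    refine ⟨i - 1, by omega, ?_⟩
    refine wp_seq (wp_add (j : ℝ) (by simp [h7]) (hs.nat_mem _ (by omega)) ?_)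
    refine wp_seq (wp_add ((n + 1 : ℕ) : ℝ) (by simp [hp₁.reg_n]) (hs.nat_mem _ (by omega)) ?_)
    refine wp_seq (wp_add ((3 * n : ℕ) : ℝ) (by simp [hp₁.reg_a]) (hs.nat_mem _ (by omega)) ?_)
    refine wp_seq (wp_update hs.nat_mem hSK (base := 3 * n) (L := L) (j := j) (by omega)
      (by simp [hp₁.reg_m]) (by simp) (by simp) (v := ((n + 1 : ℕ) : ℝ)) (by simp)
      (hs.nat_mem _ (by omega)) hj (by simpa using hf) ?_)
    intro t₂ s₂ ht₂ hreg₂ hmem₂ hf₂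
    have hr₂ : ∀ r < 8, s₂.reg r = s₁.reg r := by
      intro r hr
      rw [hreg₂ r (by omega)]
      simp (disch := omega) [if_neg]
    refine wp_seq (wp_add ((3 * n + 2 * 2 ^ L : ℕ) : ℝ) (by simp [hr₂, hp₁.reg_b])
      (hs.nat_mem _ (by omega)) ?_)
    refine wp_seq (wp_update hs.nat_mem hSK (base := 3 * n + 2 * 2 ^ L) (L := L) (j := j)
      (by omega) (by simp [hr₂, hp₁.reg_m]) (by simp) (by simp [hreg₂]) (v := ((n + 1 : ℕ) : ℝ))
      (by simp [hreg₂]) (hs.nat_mem _ (by omega)) hj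
      (by simpa using hg.congr (fun i hi _ => by simp [hmem₂ i (by omega)]) fun _ _ => rfl) ?_)
    intro t₃ s₃ ht₃ hreg₃ hmem₃ hg₃
    have hr₃ : ∀ r < 8, s₃.reg r = s₁.reg r := by
      intro r hr
      rw [hreg₃ r (by omega)]
      simp (disch := omega) [if_neg, hr₂]
    refine wp_add ((j + 1 : ℕ) : ℝ) (by simp [hr₃, h7]) (hs.nat_mem _ (by omega)) ?_
    refine ⟨by omega, j + 1, _, _, by omega, by simp, hp₁.congr ?_ ?_,
      hf₂.congr (fun i _ hi => by simp [hmem₃ i (by omega)]) (fun _ _ => rfl), by simpa using hg₃,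
      ?_, ?_⟩
    · intro r hr hr'
      simp (disch := omega) [if_neg, hr₃]
    · intro i hi
      simp (disch := omega) [hmem₃, hmem₂]
    · intro l hl
      rcases eq_or_ne l j with rfl | hne
      · simp
      · rw [Function.update_of_ne hne, hfj l (by omega)]
    · intro l hl
      rcases eq_or_ne l j with rfl | hne
      · simp
      · rw [Function.update_of_ne hne, hgj l (by omega)]
  -- Zeroed memory already is a tree with all leaves `0`, so `update` is applicable from the first
  -- round.
  · have h0 : ∀ base, 3 * n ≤ base → IsTree V s.mem base (2 ^ L) fun _ => 0 := fun base hb =>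
      ⟨fun j _ => hz _ (by omega),
        fun k _ _ => by rw [hz _ (by omega), hz _ (by omega), hz _ (by omega), min_self],
        fun k _ _ => by rw [hz _ (by omega)]; simpa using hs.nat_mem 0 (by omega)⟩
    exact ⟨0, _, _, by omega, by simp, hp.congr (fun r _ _ => by simp (disch := omega) [if_neg])
      (by simp), h0 _ le_rfl, h0 _ (by omega), by simp, by simp⟩
  · rintro t s₁ i ht ⟨j, f, g, hji, h7, hp₁, hf, hg, hfj, hgj⟩ hc
    have hj : 2 ^ L ≤ j := by
      simp only [holds_lt, val_reg, hp₁.reg_m, h7, not_lt] at hc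
      exact_mod_cast hc
    simp only [Nat.add_assoc, Nat.reduceAdd] at ht
    refine hQ _ s₁ f g (by omega) hp₁ hf hg (fun l hl => hfj l (by omega))
      (fun l hl => hgj l (by omega))

lemma wp_enter (hs : Sizes V n L P S K) (hh : Rates V n P x h) (hp : Prepared n L x h s)
    {f g : ℕ → ℝ} (hf : IsTree V s.mem (3 * n) (2 ^ L) f)
    (hg : IsTree V s.mem (3 * n + 2 * 2 ^ L) (2 ^ L) g)
    (hQ : ∀ t s' g', t ≤ n * (10 * L + 9) + 2 → Prepared n L x h s' →
      IsTree V s'.mem (3 * n) (2 ^ L) f → IsTree V s'.mem (3 * n + 2 * 2 ^ L) (2 ^ L) g' →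
      (∀ j < n, g' j = h j) → (∀ j, n ≤ j → g' j = g j) → Q t s') :
    wp S V enter s Q := by
  have hmem := hs.memory
  have hSK := hs.memory_le
  have hK := hs.time_le
  have hle := hs.le_leaves
  unfold enter
  refine wp_seq (wp_add ((0 : ℕ) : ℝ) (by simp) (hs.nat_mem _ (by omega)) ?_)
  refine wp_loop (fun i s' => ∃ j g', j + i = n ∧ s'.reg 7 = (j : ℕ) ∧ Prepared n L x h s' ∧
    IsTree V s'.mem (3 * n) (2 ^ L) f ∧ IsTree V s'.mem (3 * n + 2 * 2 ^ L) (2 ^ L) g' ∧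
    (∀ l < j, g' l = h l) ∧ ∀ l, n ≤ l → g' l = g l) (10 * L + 8) ?_ n ?_ ?_
  · rintro i s₁ ⟨j, g', hji, h7, hp₁, hf₁, hg₁, hgj, hgn⟩ hc
    have hj : j < n := by
      simp only [holds_lt, val_reg, hp₁.reg_n, h7] at hc
      exact_mod_cast hc
    refine ⟨i - 1, by omega, ?_⟩
    refine wp_seq (wp_add (j : ℝ) (by simp [h7]) (hs.nat_mem _ (by omega)) ?_)
    refine wp_seq (wp_load j (h j) (by simp [h7]) (by omega) (by simp [hp₁.rate j hj])
      (hh.mem_values j hj) ?_)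
    refine wp_seq (wp_add ((3 * n + 2 * 2 ^ L : ℕ) : ℝ) (by simp [hp₁.reg_b])
      (hs.nat_mem _ (by omega)) ?_)
    refine wp_seq (wp_update hs.nat_mem hSK (base := 3 * n + 2 * 2 ^ L) (L := L) (j := j)
      (by omega) (by simp [hp₁.reg_m]) (by simp) (by simp) (v := h j)
      (by simp) (hh.mem_values j hj) (by omega) (by simpa using hg₁) ?_)
    intro t₂ s₂ ht₂ hreg₂ hmem₂ hg₂
    have hr₂ : ∀ r < 8, s₂.reg r = s₁.reg r := by
      intro r hr
      rw [hreg₂ r (by omega)]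
      simp (disch := omega) [if_neg]
    refine wp_add ((j + 1 : ℕ) : ℝ) (by simp [hr₂, h7]) (hs.nat_mem _ (by omega)) ?_
    refine ⟨by omega, j + 1, _, by omega, by simp, hp₁.congr ?_ ?_,
      hf₁.congr (fun i _ hi => by simp [hmem₂ i (by omega)]) (fun _ _ => rfl), by simpa using hg₂,
      ?_, ?_⟩
    · intro r hr hr'
      simp (disch := omega) [if_neg, hr₂]
    · intro i hi
      simp (disch := omega) [hmem₂]
    · intro l hl
      rcases eq_or_ne l j with rfl | hne
      · simp
      · rw [Function.update_of_ne hne, hgj l (by omega)]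
    · intro l hl
      rw [Function.update_of_ne (by omega), hgn l hl]
  · exact ⟨0, g, by omega, by simp, hp.congr (fun r _ _ => by simp (disch := omega) [if_neg])
      (by simp), hf, hg, by simp, by simp⟩
  · rintro t s₁ i ht ⟨j, g', hji, h7, hp₁, hf₁, hg₁, hgj, hgn⟩ hc
    have hj : n ≤ j := by
      simp only [holds_lt, val_reg, hp₁.reg_n, h7, not_lt] at hc
      exact_mod_cast hc
    simp only [Nat.add_assoc, Nat.reduceAdd] at ht
    refine hQ _ s₁ g' (by omega) hp₁ hf₁ hg₁ (fun l hl => hgj l (by omega)) hgn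

/-- After `q` rounds of `rank`: the positions below `q` belong to the bamboos `c j`, sorted, and
these have been removed from the second tree. -/
structure Ranked (V : Set ℝ) (n L : ℕ) (x : ℝ) (h : ℕ → ℝ) (s : State) (q : ℕ) (c : ℕ → ℕ)
    (f g : ℕ → ℝ) : Prop where
  prepared : Prepared n L x h s
  name_lt : ∀ j < q, c j < n
  wait : ∀ j < q, s.mem (n + j) = ⌈x / h (c j)⌉₊
  name : ∀ j < q, s.mem (2 * n + j) = (c j + 1 : ℕ)
  tree_a : IsTree V s.mem (3 * n) (2 ^ L) f
  tree_b : IsTree V s.mem (3 * n + 2 * 2 ^ L) (2 ^ L) g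
  key : ∀ j < q, f j = ⌈x / h (c j)⌉₊
  pad_a : ∀ j, q ≤ j → j < 2 ^ L → f j = (n + 1 : ℕ)
  -- For rates as in `Rates` the key tells the two cases apart, because `h k ≤ 1 < n + 1`.
  rest : ∀ k < n, (g k = h k ∧ ∀ j < q, Slower h (c j) k) ∨ (g k = (n + 1 : ℕ) ∧ ∃ j < q, c j = k)
  pad_b : ∀ k, n ≤ k → k < 2 ^ L → g k = (n + 1 : ℕ)
  sorted : ∀ j l, j < l → l < q → Slower h (c j) (c l)

/-- Pigeonhole; it guarantees that a rate is still in the tree before each extraction. -/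
lemma exists_not_image {n q : ℕ} (hq : q < n) (c : ℕ → ℕ) : ∃ k < n, ∀ j < q, c j ≠ k := by
  by_contra! hall
  have hsub : Finset.range n ⊆ (Finset.range q).image c := fun k hk => by
    obtain ⟨j, hj, hjk⟩ := hall k (Finset.mem_range.1 hk)
    exact Finset.mem_image.2 ⟨j, Finset.mem_range.2 hj, hjk⟩
  have := (Finset.card_le_card hsub).trans Finset.card_image_le
  simp at this
  omega

/-- The next bamboo to extract. -/
lemma Ranked.next {q : ℕ} {c : ℕ → ℕ} {f g : ℕ → ℝ} (hr : Ranked V n L x h s q c f g)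
    (hh : Rates V n P x h) (hL : n ≤ 2 ^ L) (hq : q < n) {k : ℕ} (hk : k < 2 ^ L)
    (hroot : g k ≤ s.mem (3 * n + 2 * 2 ^ L + 1))
    (hlast : ∀ l, k < l → l < 2 ^ L → s.mem (3 * n + 2 * 2 ^ L + 1) < g l) :
    k < n ∧ (∀ j < q, Slower h (c j) k) ∧
      ∀ l < n, l ≠ k → (∀ j < q, Slower h (c j) l) → g l = h l → Slower h k l := by
  obtain ⟨i, hi, hci⟩ := exists_not_image hq c
  have hgi : g i = h i := by
    rcases hr.rest i hi with h1 | ⟨-, j, hj, h2⟩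
    · exact h1.1
    · exact absurd h2 (hci j hj)
  have hmin : ∀ l < 2 ^ L, g k ≤ g l := fun l hl => hroot.trans (hr.tree_b.root_le hl)
  -- A remaining rate is at most `1`, so the minimum is neither padding nor an extracted leaf.
  have hlt : g k < (n + 1 : ℕ) := by
    have h1 := hmin i (by omega)
    have h2 := hh.le_one i hi
    have h3 : (1 : ℝ) ≤ n := by exact_mod_cast (by omega : 1 ≤ n)
    push_cast
    linarith
  have hkn : k < n := by
    by_contra hkn
    exact hlt.ne (hr.pad_b k (by omega) hk)
  obtain ⟨hgk, hslow⟩ : g k = h k ∧ ∀ j < q, Slower h (c j) k := by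
    rcases hr.rest k hkn with h1 | h1
    · exact h1
    · exact absurd h1.1 hlt.ne
  refine ⟨hkn, hslow, fun l hl hlk _ hgl => ?_⟩
  have h1 := hmin l (by omega)
  rw [hgk, hgl] at h1
  rcases h1.lt_or_eq with h2 | h2
  · exact Or.inl h2
  · refine Or.inr ⟨h2, ?_⟩
    -- An equal rate at a later leaf is impossible, as `k` is the last leaf that attains the
    -- minimum.
    by_contra hkl
    have h3 := hlast l (by omega) (by omega)
    rw [hgl, ← h2, ← hgk] at h3
    exact absurd hroot h3.not_ge

-- A selection sort: searching with the root as threshold finds the last minimal leaf, which is then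
-- overwritten by `n + 1`. Extracting the larger index first among equal rates makes the rightmost
-- choice of a query the smallest index. A round costs one search and two updates, hence `27` per
-- level.
set_option maxHeartbeats 1000000 in
lemma wp_rank (hs : Sizes V n L P S K) (hh : Rates V n P x h) {c f g : _}
    (hr : Ranked V n L x h s 0 c f g)
    (hQ : ∀ t s' c' f' g', t ≤ n * (27 * L + 30) + 2 → Ranked V n L x h s' n c' f' g' → Q t s') :
    wp S V rank s Q := by
  have hmem := hs.memory
  have hSK := hs.memory_le
  have hK := hs.time_le
  have hle := hs.le_leaves
  unfold rank
  refine wp_seq (wp_add ((0 : ℕ) : ℝ) (by simp) (hs.nat_mem _ (by omega)) ?_)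
  refine wp_loop (fun i s' => ∃ q c f g, q + i = n ∧ s'.reg 7 = (q : ℕ) ∧
    Ranked V n L x h s' q c f g) (27 * L + 29) ?_ n ?_ ?_
  · clear hr
    rintro i s₁ ⟨q, c, f, g, hqi, h7, hr⟩ hc
    have hp := hr.prepared
    have hq : q < n := by
      simp only [holds_lt, val_reg, hp.reg_n, h7] at hc
      exact_mod_cast hc
    refine ⟨i - 1, by omega, ?_⟩
    refine wp_seq (wp_add ((3 * n + 2 * 2 ^ L : ℕ) : ℝ) (by simp [hp.reg_b])
      (hs.nat_mem _ (by omega)) ?_)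
    refine wp_seq (wp_add ((3 * n + 2 * 2 ^ L + 1 : ℕ) : ℝ) (by simp)
      (hs.nat_mem _ (by omega)) ?_)
    refine wp_seq (wp_load (3 * n + 2 * 2 ^ L + 1) _ (by simp) (by omega) rfl
      (by simpa using hr.tree_b.mem_values 1 le_rfl (by omega)) ?_)
    refine wp_seq (wp_find hs.nat_mem hSK (base := 3 * n + 2 * 2 ^ L) (L := L)
      (θ := s₁.mem (3 * n + 2 * 2 ^ L + 1)) (f := g) (by omega)
      (by simp [hp.reg_m]) (by simp) (by simp) (by simpa using hr.tree_b) (by simp) ?_)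
    intro t₂ s₂ k ht₂ hreg₂ hmem₂ h9₂ hkL hroot hlast
    obtain ⟨hkn, hslow, hnext⟩ := hr.next hh hle hq hkL hroot hlast
    have hr₂ : ∀ r < 8, s₂.reg r = s₁.reg r := by
      intro r hr
      rw [hreg₂ r (by omega) (by omega)]
      simp (disch := omega) [if_neg]
    have hm₂ : s₂.mem = s₁.mem := by simpa using hmem₂
    have h8₂ : s₂.reg 8 = (3 * n + 2 * 2 ^ L : ℕ) := by simp [hreg₂]
    refine wp_seq (wp_add ((n + 1 : ℕ) : ℝ) (by simp [hr₂, hp.reg_n])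
      (hs.nat_mem _ (by omega)) ?_)
    refine wp_seq (wp_update hs.nat_mem hSK (base := 3 * n + 2 * 2 ^ L) (L := L) (j := k)
      (by omega) (by simp [hr₂, hp.reg_m]) (by simp [h8₂]) (by simp [h9₂])
      (v := ((n + 1 : ℕ) : ℝ)) (by simp)
      (hs.nat_mem _ (by omega)) hkL (by simpa [hm₂] using hr.tree_b) ?_)
    intro t₃ s₃ ht₃ hreg₃ hmem₃ hg₃
    have hr₃ : ∀ r < 8, s₃.reg r = s₁.reg r := by
      intro r hr
      rw [hreg₃ r (by omega)]
      simp (disch := omega) [if_neg, hr₂]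
    have hm₃ : ∀ i < 3 * n + 2 * 2 ^ L, s₃.mem i = s₁.mem i := by
      intro i hi
      rw [hmem₃ i (by omega)]
      simp [hm₂]
    have h9₃ : s₃.reg 9 = k := by simp [hreg₃, h9₂]
    have hpos := hh.pos k hkn
    have hceil := hh.ceil_le k hkn
    generalize hw : ⌈x / h k⌉₊ = w at *
    refine wp_seq (wp_load k (h k) (by simp [h9₃]) (by omega)
      (by rw [hm₃ k (by omega), hp.rate k hkn]) (hh.mem_values k hkn) ?_)
    refine wp_seq (wp_ceilDiv w (by simpa using hpos) (by simp [hr₃, hp.reg_x, hh.x_pos.le])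
      (by simpa [hr₃, hp.reg_x] using hw) (hs.nat_mem _ (by omega)) ?_)
    refine wp_seq (wp_add ((n + q : ℕ) : ℝ) (by simp [hr₃, hp.reg_n, h7])
      (hs.nat_mem _ (by omega)) ?_)
    refine wp_seq (wp_store (n + q) w (by simp) (by omega) (by simp)
      (hs.nat_mem _ (by omega)) ?_)
    refine wp_seq (wp_add ((2 * n + q : ℕ) : ℝ) (by simp [hr₃, hp.reg_n]; ring)
      (hs.nat_mem _ (by omega)) ?_)
    refine wp_seq (wp_add ((k + 1 : ℕ) : ℝ) (by simp [h9₃]) (hs.nat_mem _ (by omega)) ?_)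
    refine wp_seq (wp_store (2 * n + q) ((k + 1 : ℕ) : ℝ) (by simp) (by omega) (by simp)
      (hs.nat_mem _ (by omega)) ?_)
    refine wp_seq (wp_add (q : ℝ) (by simp [hr₃, h7]) (hs.nat_mem _ (by omega)) ?_)
    refine wp_seq (wp_add ((3 * n : ℕ) : ℝ) (by simp [hr₃, hp.reg_a])
      (hs.nat_mem _ (by omega)) ?_)
    refine wp_seq (wp_update hs.nat_mem hSK (base := 3 * n) (L := L) (j := q)
      (by omega) (by simp [hr₃, hp.reg_m]) (by simp) (by simp) (v := (w : ℝ)) (by simp)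
      (hs.nat_mem _ (by omega)) (by omega) (hr.tree_a.congr (fun i _ _ => by
        simp (disch := omega) only [setReg_mem, setMem_mem, if_neg, hm₃]) fun _ _ => rfl) ?_)
    intro t₄ s₄ ht₄ hreg₄ hmem₄ hf₄
    have hr₄ : ∀ r < 8, s₄.reg r = s₁.reg r := by
      intro r hr
      rw [hreg₄ r (by omega)]
      simp (disch := omega) [if_neg, hr₃]
    have hm₄ : ∀ i < 3 * n, s₄.mem i = if i = 2 * n + q then ((k + 1 : ℕ) : ℝ) else
        if i = n + q then (w : ℝ) else s₁.mem i := by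
      intro i hi
      rw [hmem₄ i (by omega)]
      simp only [setReg_mem, setMem_mem, hm₃ i (by omega)]
    refine wp_add ((q + 1 : ℕ) : ℝ) (by simp [hr₄, h7]) (hs.nat_mem _ (by omega)) ?_
    refine ⟨by omega, q + 1, Function.update c q k, _, _, by omega, by simp,
      { prepared := hp.congr ?_ ?_
        name_lt := ?_
        wait := ?_
        name := ?_
        tree_a := by simpa using hf₄
        tree_b := hg₃.congr (fun i hi _ => by
          rw [setReg_mem, hmem₄ i (by omega)]
          simp (disch := omega) only [setReg_mem, setMem_mem, if_neg]) fun _ _ => rfl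
        key := ?_
        pad_a := ?_
        rest := ?_
        pad_b := ?_
        sorted := ?_ }⟩
    · intro r hr hr'
      simp (disch := omega) [if_neg, hr₄]
    · intro i hi
      rw [setReg_mem, hm₄ i (by omega), if_neg (by omega), if_neg (by omega)]
    · intro j hj
      rcases eq_or_ne j q with rfl | hne
      · simpa using hkn
      · simpa [hne] using hr.name_lt j (by omega)
    · intro j hj
      rw [setReg_mem, hm₄ _ (by omega), if_neg (by omega)]
      rcases eq_or_ne j q with rfl | hne
      · simp [hw]
      · simpa [hne] using hr.wait j (by omega)
    · intro j hj
      rw [setReg_mem, hm₄ _ (by omega)]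
      rcases eq_or_ne j q with rfl | hne
      · simp
      · rw [if_neg (by omega), if_neg (by omega), Function.update_of_ne hne]
        exact hr.name j (by omega)
    · intro j hj
      rcases eq_or_ne j q with rfl | hne
      · simp [hw]
      · simpa [hne] using hr.key j (by omega)
    · intro j hj hj'
      rw [Function.update_of_ne (by omega), hr.pad_a j (by omega) hj']
    · intro l hl
      rcases eq_or_ne l k with rfl | hne
      · exact Or.inr ⟨by simp, q, by omega, by simp⟩
      · rw [Function.update_of_ne hne]
        rcases hr.rest l hl with ⟨h1, h2⟩ | ⟨h1, j, hj, h2⟩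
        · refine Or.inl ⟨h1, fun j hj => ?_⟩
          rcases eq_or_ne j q with rfl | hjq
          · simpa using hnext l hl hne h2 h1
          · simpa [hjq] using h2 j (by omega)
        · refine Or.inr ⟨h1, j, by omega, ?_⟩
          rwa [Function.update_of_ne (by omega)]
    · intro l hl hl'
      rw [Function.update_of_ne (by omega), hr.pad_b l hl hl']
    · intro j l hjl hl
      rw [Function.update_of_ne (by omega : j ≠ q)]
      rcases eq_or_ne l q with rfl | hne
      · simpa using hslow j hjl
      · simpa [hne] using hr.sorted j l hjl (by omega)
  · refine ⟨0, c, f, g, by omega, by simp, { hr with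
      prepared := hr.prepared.congr (fun r _ _ => by simp (disch := omega) [if_neg]) (by simp) }⟩
  · rintro t s₁ i ht ⟨q, c, f, g, hqi, h7, hr⟩ hc
    have hq : n ≤ q := by
      simp only [holds_lt, val_reg, hr.prepared.reg_n, h7, not_lt] at hc
      exact_mod_cast hc
    obtain rfl : q = n := by omega
    simp only [Nat.add_assoc, Nat.reduceAdd] at ht
    exact hQ _ s₁ c f g (by omega) hr

end building
lemma Exec.mono {S S' : ℕ} {V : Set ℝ} (hS : S ≤ S') {p : Prog} {s s' : State} {t : ℕ}
    (h : Exec S V p s t s') : Exec S' V p s t s' := by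
  induction h with
  | skip s => exact .skip s
  | arith s dst op a b hdef hV => exact .arith s dst op a b hdef hV
  | load s dst addr k ha hk hV => exact .load s dst addr k ha (hk.trans_le hS) hV
  | store s addr src k ha hk hV => exact .store s addr src k ha (hk.trans_le hS) hV
  | seq p q s s' s'' t t' _ _ ih ih' => exact .seq p q s s' s'' t t' ih ih'
  | branch_true c p q s s' t hc _ ih => exact .branch_true c p q s s' t hc ih
  | branch_false c p q s s' t hc _ ih => exact .branch_false c p q s s' t hc ih
  | loop_stop c p s hc => exact Exec.loop_stop c p s hc
  | loop_step c p s s' s'' t t' hc _ _ ih ih' => exact .loop_step c p s s' s'' t t' hc ih ih'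

/-- At the end of day `0` every bamboo has grown for one day and the clock is `1`, so the waiting
times themselves are the correct initial keys. -/
lemma wp_build {V : Set ℝ} {n P S K : ℕ} {x : ℝ} {h : ℕ → ℝ} {s : State}
    (hs : Sizes V n (Nat.clog 2 n) P S K) (hh : Rates V n P x h) (hn : 1 ≤ n)
    (h0 : s.reg 0 = n) (h1 : s.reg 1 = x) (hm : ∀ i < n, s.mem i = h i)
    (hz : ∀ i, n ≤ i → s.mem i = 0) :
    wp S V build s fun t s' =>
      t ≤ 2 ^ Nat.clog 2 n * (20 * Nat.clog 2 n + 14) + n * (37 * Nat.clog 2 n + 39) +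
        2 * Nat.clog 2 n + 14 ∧
      ∃ c : ℕ → ℕ, (∀ j < n, c j < n) ∧ (∀ j l, j < l → l < n → Slower h (c j) (c l)) ∧
        Ready V n (Nat.clog 2 n) P S (fun j => ⌈x / h (c j)⌉₊) c s' fun _ => 1 := by
  have hK := hs.time_le
  have hmemory := hs.memory
  have hle := hs.le_leaves
  unfold build
  refine wp_seq (wp_setup hs h0 h1 hm ?_)
  intro t₁ s₁ ht₁ hm₁ hp₁
  generalize Nat.clog 2 n = L at *
  refine wp_seq (wp_blank hs hp₁ (fun i hi => by rw [hm₁, hz i hi]) ?_)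
  intro t₂ s₂ f g ht₂ hp₂ hf hg hfn hgn
  refine wp_seq (wp_enter hs hh hp₂ hf hg ?_)
  intro t₃ s₃ g' ht₃ hp₃ hf₃ hg₃ hg' hgn'
  have h₃ : Ranked V n L x h s₃ 0 (fun _ => 0) f g' :=
    { prepared := hp₃
      name_lt := by simp
      wait := by simp
      name := by simp
      tree_a := hf₃
      tree_b := hg₃
      key := by simp
      pad_a := fun j _ hj => hfn j hj
      rest := fun k hk => Or.inl ⟨hg' k hk, by simp⟩
      pad_b := fun k hk hk' => by rw [hgn' k hk, hgn k hk']
      sorted := by simp }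
  refine wp_seq (wp_rank hs hh h₃ ?_)
  intro t₄ s₄ c f₄ g₄ ht₄ hr
  refine wp_add ((1 : ℕ) : ℝ) (by simp) (hs.nat_mem _ (by omega)) ?_
  have hp := hr.prepared
  refine ⟨?_, c, hr.name_lt, hr.sorted, 3 * n, 3 * n + 2 * 2 ^ L, 1,
    fun j => if j < n then ⌈x / h (c j)⌉₊ else n + 1, g₄,
    { reg_n := by simp [hp.reg_n]
      reg_m := by simp [hp.reg_m]
      reg_a := by simp [hp.reg_a]
      reg_b := by simp [hp.reg_b]
      reg_clock := by simp
      le_a := le_rfl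
      le_b := by omega
      a_le := by omega
      b_le := by omega
      disjoint := Or.inl le_rfl
      clock_pos := le_rfl
      clock_le := hn
      wait := hr.wait
      wait_le := fun j hj => hh.ceil_le _ (hr.name_lt j hj)
      wait_pos := fun j hj =>
        Nat.ceil_pos.2 (div_pos hh.x_pos (hh.pos _ (hr.name_lt j hj)))
      name := hr.name
      name_lt := hr.name_lt
      tree_a := hr.tree_a.congr (fun _ _ _ => rfl) fun j hj => by
        split_ifs with hjn
        · rw [hr.key j hjn]
        · rw [hr.pad_a j (by omega) hj]
      tree_b := hr.tree_b
      key_le := fun j hj => by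
        have := hh.ceil_le _ (hr.name_lt j hj)
        simp only [hj, if_true]
        omega
      pad_a := fun j hj _ => by simp [hj.not_gt]
      pad_b := hr.pad_b }, by simp, fun j hj => by simp [hj]⟩
  have e1 : n * (37 * L + 39) = n * (10 * L + 9) + n * (27 * L + 30) := by ring
  omega

/-! ### The schedule -/

section schedule

variable {n : ℕ} {G : Garden n} {x : ℝ}

/-- The choices of the data structure are those of Reduce-Fastest. -/
lemma isReduceFastest_of_isChoice {c : ℕ → Fin n} (hinj : ∀ j < n, ∀ l < n, c j = c l → j = l)
    (hsurj : ∀ i, ∃ j < n, c j = i)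
    (hsort : ∀ j l, j < l → l < n → G.rate (c j) < G.rate (c l) ∨
      G.rate (c j) = G.rate (c l) ∧ c l ≤ c j)
    {e : ℕ → ℕ → ℕ} {o : ℕ → Option ℕ} (h0 : ∀ j, e 0 j = 1)
    (hstep : ∀ d, e (d + 1) = nextAge (e d) (o d))
    (ho : ∀ d, IsChoice n (fun j => ⌈x / G.rate (c j)⌉₊) (e d) (o d)) :
    G.IsReduceFastest x fun d => (o d).map c := by
  set s : Schedule n := fun d => (o d).map c with hs
  have hlt : ∀ d k, o d = some k → k < n := fun d k hk => by
    have := ho d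
    rw [hk] at this
    exact this.1
  have hsome : ∀ d, ∀ j < n, s d = some (c j) ↔ o d = some j := by
    intro d j hj
    simp only [hs, Option.map_eq_some_iff]
    refine ⟨?_, fun h => ⟨j, h, rfl⟩⟩
    rintro ⟨k, hk, hkj⟩
    rw [hk, hinj k (hlt d k hk) j hj hkj]
  -- A bamboo trimmed at the end of a day shows one day of growth at the end of the next; hence the
  -- value `1` in `nextAge`.
  have hheight : ∀ d, ∀ j < n, G.height s d (c j) = e d j * G.rate (c j) := by
    intro d j hj
    induction d with
    | zero => simp [Garden.height, h0]
    | succ d ih =>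
      rw [Garden.height, hstep, nextAge]
      by_cases hd : o d = some j
      · simp [(hsome d j hj).2 hd, hd]
      · rw [if_neg (mt (hsome d j hj).1 hd), if_neg hd, ih]
        push_cast
        ring
  have hiff : ∀ d, ∀ j < n, x ≤ G.height s d (c j) ↔ ⌈x / G.rate (c j)⌉₊ ≤ e d j := by
    intro d j hj
    rw [hheight d j hj, Nat.ceil_le, div_le_iff₀ (G.rate_pos _)]
  intro d
  have hod := ho d
  refine ⟨fun hnone i => ?_, fun i hi => ?_⟩
  · obtain ⟨j, hj, rfl⟩ := hsurj i
    have : o d = none := by simpa [hs] using hnone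
    rw [this] at hod
    rw [← not_le, hiff d j hj]
    exact (hod j hj).not_ge
  · obtain ⟨k, hk, rfl⟩ := Option.map_eq_some_iff.1 hi
    rw [hk] at hod
    obtain ⟨hkn, hke, hlast⟩ := hod
    refine ⟨(hiff d k hkn).2 hke, fun i hi => ?_⟩
    obtain ⟨j, hj, rfl⟩ := hsurj i
    rw [hiff d j hj] at hi
    rcases lt_trichotomy j k with h | rfl | h
    · exact hsort j k h hkn
    · exact Or.inr ⟨rfl, le_rfl⟩
    · exact absurd hi (hlast j h hj).not_ge

/-! ### Bounds on memory and on the integers that occur -/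

lemma Garden.pos (G : Garden n) : 1 ≤ n := by
  rcases Nat.eq_zero_or_pos n with rfl | hn
  · simpa using G.sum_rate
  · exact hn

lemma Garden.rate_le_one (G : Garden n) (i : Fin n) : G.rate i ≤ 1 := by
  rw [← G.sum_rate]
  exact Finset.single_le_sum (fun j _ => (G.rate_pos j).le) (Finset.mem_univ i)

lemma two_pow_clog_le (hn : 1 ≤ n) : 2 ^ Nat.clog 2 n ≤ 2 * n := by
  rcases Nat.eq_zero_or_pos (Nat.clog 2 n) with h | h
  · rw [h]
    omega
  · have h1 : 2 ^ (Nat.clog 2 n - 1) < n :=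
      (Nat.lt_clog_iff_pow_lt (by norm_num)).1 (by omega)
    have h2 : 2 ^ Nat.clog 2 n = 2 * 2 ^ (Nat.clog 2 n - 1) := by
      rw [← pow_succ', Nat.sub_add_cancel h]
    omega

lemma clog_two_le_log_add_one (n : ℕ) : Nat.clog 2 n ≤ Nat.log 2 n + 1 :=
  Nat.clog_le_of_le_pow (Nat.lt_pow_succ_log_self (by norm_num) n).le

/-- The largest waiting time bounds all others, and the integers that occur are allowed values. -/
lemma exists_sizes (G : Garden n) (hx : 0 < x) (C : ℕ) (hC : 13 ≤ C) :
    ∃ P, (∀ i, ⌈x / G.rate i⌉₊ ≤ P) ∧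
      Sizes (allowedValues G x C) n (Nat.clog 2 n) P (11 * n) (11 * n + P + 1) := by
  have hn := G.pos
  have : Nonempty (Fin n) := ⟨⟨0, hn⟩⟩
  obtain ⟨i₀, hi₀⟩ := Finite.exists_min G.rate
  -- The slowest bamboo waits longest. The memory bound `11 * n` comes from three tables of length
  -- `n` and two trees, `3 * n + 4 * 2 ^ L` with `2 ^ L ≤ 2 * n`.
  refine ⟨⌈x / G.rate i₀⌉₊, fun i => Nat.ceil_mono ?_, ?_, ?_, by omega, by omega, ?_⟩
  · exact div_le_div_of_nonneg_left hx.le (G.rate_pos _) (hi₀ i)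
  · exact Nat.le_pow_clog (by norm_num) n
  · have := two_pow_clog_le hn
    omega
  · intro z hz
    refine Or.inr (Or.inr ⟨z, rfl, i₀, ?_⟩)
    have hpos : 0 < x / G.rate i₀ := div_pos hx (G.rate_pos _)
    -- Rounding up costs at most `1`, and `1 ≤ n`, so the bound is at most `13 * n + x / G.rate i₀`;
    -- this is the origin of `13`.
    have h1 : (|z| : ℝ) ≤ 11 * n + ⌈x / G.rate i₀⌉₊ + 1 := by exact_mod_cast hz
    have h2 := (Nat.ceil_lt_add_one hpos.le).le
    have h3 : (1 : ℝ) ≤ n := by exact_mod_cast hn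
    have h4 : (13 : ℝ) ≤ C := by exact_mod_cast hC
    nlinarith [mul_le_mul_of_nonneg_right h4 (by positivity : 0 ≤ (n : ℝ) + x / G.rate i₀)]

/-- Repeated queries yield a schedule of Reduce-Fastest. -/
lemma exists_schedule {V : Set ℝ} {L P S K : ℕ} (hs : Sizes V n L P S K) {c : ℕ → Fin n}
    (hinj : ∀ j < n, ∀ l < n, c j = c l → j = l) (hsurj : ∀ i, ∃ j < n, c j = i)
    (hsort : ∀ j l, j < l → l < n → G.rate (c j) < G.rate (c l) ∨
      G.rate (c j) = G.rate (c l) ∧ c l ≤ c j)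
    {s₀ : State} (h₀ : Ready V n L P S (fun j => ⌈x / G.rate (c j)⌉₊) (fun j => c j) s₀
      fun _ => 1) :
    ∃ s, G.IsReduceFastest x s ∧ ∃ σ : ℕ → State, σ 0 = s₀ ∧
      ∀ d, (∃ t ≤ 37 * L + 120, Exec S V query (σ d) t (σ (d + 1))) ∧
        (σ (d + 1)).reg 0 = encodeAnswer (s d) := by
  set p : ℕ → ℕ := fun j => ⌈x / G.rate (c j)⌉₊
  set c' : ℕ → ℕ := fun j => c j
  -- The recursion runs over machine states bundled with the ages and the invariant, so that a
  -- successor can be chosen at every day.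
  have step : ∀ w : {w : State × (ℕ → ℕ) // Ready V n L P S p c' w.1 w.2},
      ∃ (w' : {w : State × (ℕ → ℕ) // Ready V n L P S p c' w.1 w.2}) (o : Option ℕ),
        (∃ t ≤ 37 * L + 120, Exec S V query w.1.1 t w'.1.1) ∧ IsChoice n p w.1.2 o ∧
        w'.1.1.reg 0 = answer c' o ∧ w'.1.2 = nextAge w.1.2 o := by
    rintro ⟨⟨s, e⟩, hw⟩
    obtain ⟨t, s', he, ht, o, ho, h0, hr⟩ := wp_query hs hw
    exact ⟨⟨⟨s', nextAge e o⟩, hr⟩, o, ⟨t, ht, he⟩, ho, h0, rfl⟩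
  choose next o hexec hchoice hans hage using step
  let W : ℕ → {w : State × (ℕ → ℕ) // Ready V n L P S p c' w.1 w.2} :=
    fun d => Nat.rec ⟨⟨s₀, fun _ => 1⟩, h₀⟩ (fun _ => next) d
  refine ⟨fun d => (o (W d)).map c, isReduceFastest_of_isChoice hinj hsurj hsort
    (e := fun d => (W d).1.2) (fun _ => rfl) (fun d => hage (W d)) (fun d => hchoice (W d)),
    fun d => (W d).1.1, rfl, fun d => ⟨hexec (W d), (hans (W d)).trans ?_⟩⟩
  simp only
  cases o (W d) <;> simp [answer, encodeAnswer, c']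

end schedule

end BGT

/-! ### Assembling the oracle and its constants -/

theorem mainTheorem4 :
    ∃ (O : BGT.TrimmingOracle) (C : ℕ), ∀ (n : ℕ) (G : BGT.Garden n) (x : ℝ), 0 < x →
      ∃ s : BGT.Schedule n, G.IsReduceFastest x s ∧
        O.Follows G x s (C * n) (BGT.allowedValues G x C)
          (C * (n * (Nat.log 2 n + 1))) (C * (Nat.log 2 n + 1)) := by
  -- A generous constant: memory needs `11`, stored integers `13`, a query `157` and the
  -- construction `160`.
  refine ⟨⟨BGT.build, BGT.query⟩, 200, fun n G x hx => ?_⟩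
  have hn := G.pos
  obtain ⟨P, hP, hs⟩ := BGT.exists_sizes G hx 200 (by norm_num)
  set h : ℕ → ℝ := fun k => if hk : k < n then G.rate ⟨k, hk⟩ else 0 with hdef
  have hval : ∀ i (hi : i < n), h i = G.rate ⟨i, hi⟩ := fun i hi => by simp [hdef, hi]
  have hh : BGT.Rates (BGT.allowedValues G x 200) n P x h :=
    { pos := fun i hi => by rw [hval i hi]; exact G.rate_pos _
      le_one := fun i hi => by rw [hval i hi]; exact G.rate_le_one _
      mem_values := fun i hi => by rw [hval i hi]; exact Or.inr (Or.inl ⟨_, rfl⟩)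
      x_pos := hx
      ceil_le := fun i hi => by rw [hval i hi]; exact hP _ }
  obtain ⟨t, s₀, hbuild, ht, c, hc, hsort, hready⟩ :=
    BGT.wp_build (s := BGT.inputState G x) hs hh hn (by simp [BGT.inputState])
      (by simp [BGT.inputState]) (fun i _ => rfl)
      (fun i hi => by simp [BGT.inputState, hi.not_gt])
  have hinj : ∀ j < n, ∀ l < n, c j = c l → j = l := by
    intro j hj l hl hjl
    rcases lt_trichotomy j l with hlt | heq | hlt
    · exact absurd hjl (hsort j l hlt hl).ne
    · exact heq
    · exact absurd hjl.symm (hsort l j hlt hj).ne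
  -- The remainder only makes the map total; for positions below `n` it changes nothing.
  let c' : ℕ → Fin n := fun j => ⟨c j % n, Nat.mod_lt _ hn⟩
  have hc' : ∀ j < n, (c' j : ℕ) = c j := fun j hj => Nat.mod_eq_of_lt (hc j hj)
  have hrate : ∀ j < n, h (c j) = G.rate (c' j) := fun j hj => by
    rw [hval _ (hc j hj)]
    congr 1
    exact Fin.ext (hc' j hj).symm
  have hinj' : ∀ j < n, ∀ l < n, c' j = c' l → j = l := by
    intro j hj l hl hjl
    apply hinj j hj l hl
    rw [← hc' j hj, ← hc' l hl, hjl]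
  have hsurj : ∀ i, ∃ j < n, c' j = i := by
    have : Function.Injective fun j : Fin n => c' j := fun j l hjl =>
      Fin.ext (hinj' j j.2 l l.2 hjl)
    intro i
    obtain ⟨j, hj⟩ := (Finite.injective_iff_surjective.1 this) i
    exact ⟨j, j.2, hj⟩
  have hready' : BGT.Ready (BGT.allowedValues G x 200) n (Nat.clog 2 n) P (11 * n)
      (fun j => ⌈x / G.rate (c' j)⌉₊) (fun j => c' j) s₀ fun _ => 1 := by
    obtain ⟨a, b, τ, κ, g, hst, hsync, hage⟩ := hready
    refine ⟨a, b, τ, κ, g, { hst with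
      wait := fun j hj => by rw [← hrate j hj, hst.wait j hj]
      wait_le := fun j hj => by rw [← hrate j hj]; exact hst.wait_le j hj
      wait_pos := fun j hj => by rw [← hrate j hj]; exact hst.wait_pos j hj
      name := fun j hj => by rw [hc' j hj, hst.name j hj]
      name_lt := fun j _ => (c' j).2 }, hsync, fun j hj => by simpa only [hrate j hj] using hage j hj⟩
  obtain ⟨s, hfast, σ, hσ, hrun⟩ := BGT.exists_schedule hs hinj' hsurj (fun j l hjl hl => by
    rcases hsort j l hjl hl with h1 | ⟨h1, h2⟩
    · rw [hrate j (by omega), hrate l hl] at h1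
      exact Or.inl h1
    · rw [hrate j (by omega), hrate l hl] at h1
      refine Or.inr ⟨h1, ?_⟩
      rw [Fin.le_def, hc' j (by omega), hc' l hl]
      exact h2.le) hready'
  have hL := BGT.clog_two_le_log_add_one n
  have hpow := BGT.two_pow_clog_le hn
  have hS : 11 * n ≤ 200 * n := by omega
  refine ⟨s, hfast, σ, ⟨t, ht.trans ?_, hσ ▸ hbuild.mono hS⟩, fun d => ?_⟩
  · have h1 : 2 ^ Nat.clog 2 n * (20 * Nat.clog 2 n + 14) ≤
        2 * n * (20 * (Nat.log 2 n + 1) + 14) := by gcongr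
    have h2 : n * (37 * Nat.clog 2 n + 39) ≤ n * (37 * (Nat.log 2 n + 1) + 39) := by gcongr
    have h3 : 1 * (Nat.log 2 n + 1) ≤ n * (Nat.log 2 n + 1) := by gcongr
    nlinarith
  · obtain ⟨⟨t, ht, he⟩, hans⟩ := hrun d
    exact ⟨⟨t, by omega, he.mono hS⟩, hans⟩
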